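/- Let $G$ be a finite simple bipartite graph whose vertex set $V(G)=\{x_1,\dots,x_n\}$ is the disjoint union of $X$ and $Y$, with every edge joining a vertex of $X$ to a vertex of $Y$. Let $\mathbb K$ be any field, $S=\mathbb K[x_1,\dots,x_n]$, and let $I(G)=(x_ix_j : x_ix_j\in E(G))\subseteq S$ be the edge ideal of $G$. For a positive integer $s$, let $I(G)^{[s]}$ be the $s$-th squarefree power of $I(G)$, i.e. the ideal of $S$ generated by the squarefree monomials that belong to $I(G)^s$. Let $\mathrm{match}(G)$ be the largest number of edges in a matching of $G$. For a nonzero homogeneous ideal $J\subseteq S$, let $\mathrm{reg}(J)=\max\{j-i : \beta_{i,j}(J)\neq 0\}$ be its Castelnuovo--Mumford regularity, where $\beta_{i,j}(J)$ is the number of summands $S(-j)$ in homological degree $i$ of the minimal graded free resolution of $J$ as an $S$-module. Then for every integer $s$ with $1\le s\le \mathrm{match}(G)$, $$\mathrm{reg}\big(I(G)^{[s]}\big)\le \min\{|X|,|Y|\}+s.$$ -/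

import Mathlib

namespace SquarefreePowers

/-- The edge ideal of a graph on the vertex set `V`, in the polynomial ring over `K` whose
variables are the vertices. -/
noncomputable def edgeIdeal {V : Type*} (K : Type*) [Field K] (G : SimpleGraph V) :
    Ideal (MvPolynomial V K) :=
  Ideal.span {f | ∃ u v : V, G.Adj u v ∧ f = MvPolynomial.X u * MvPolynomial.X v}

/-- The `s`-th squarefree power of `I`: the ideal generated by the squarefree monomials that
belong to `I ^ s`. -/
noncomputable def squarefreePower {V K : Type*} [Field K] (I : Ideal (MvPolynomial V K)) (s : ℕ) :
    Ideal (MvPolynomial V K) :=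
  Ideal.span {f | ∃ m : V →₀ ℕ, (∀ v, m v ≤ 1) ∧ f = MvPolynomial.monomial m 1 ∧ f ∈ I ^ s}

/-- The largest number of edges in a matching of a finite graph. -/
noncomputable def matchingNumber {V : Type*} [Finite V] (G : SimpleGraph V) : ℕ :=
  sSup {k | ∃ M : G.Subgraph, M.IsMatching ∧ M.edgeSet.ncard = k}

/-- The vector `w` is homogeneous of degree `n` in the graded free module `⨁ₐ S(-deg a)`, that is,
each coordinate `w a` is zero or a form of degree `n - deg a`. -/
def IsHomogeneousVector {V K ι : Type*} [Field K] (deg : ι → ℕ) (n : ℕ)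
    (w : ι → MvPolynomial V K) : Prop :=
  ∀ a, ∀ m ∈ (w a).support, m.degree + deg a = n

/-- A minimal graded free resolution
`⋯ ⟶ F₂ ⟶ F₁ ⟶ F₀ ⟶ I ⟶ 0` of the ideal `I` of `S = K[V]`, with
`Fᵢ = ⨁ₐ S(-deg i a)`, where `a` runs over the `rank i` basis elements of `Fᵢ`.
The maps are homogeneous of degree zero, and the image of each differential
lies in the irrelevant maximal ideal times its target. -/
structure MinimalGradedFreeResolution {V K : Type*} [Field K]
    (I : Ideal (MvPolynomial V K)) where
  rank : ℕ → ℕ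
  deg : (i : ℕ) → Fin (rank i) → ℕ
  ε : (Fin (rank 0) → MvPolynomial V K) →ₗ[MvPolynomial V K] MvPolynomial V K
  d : (i : ℕ) → (Fin (rank (i + 1)) → MvPolynomial V K) →ₗ[MvPolynomial V K]
    (Fin (rank i) → MvPolynomial V K)
  ε_homogeneous : ∀ a, (ε (Pi.single a 1)).IsHomogeneous (deg 0 a)
  d_homogeneous : ∀ i b, IsHomogeneousVector (deg i) (deg (i + 1) b) (d i (Pi.single b 1))
  range_ε : LinearMap.range ε = I
  exact_zero : Function.Exact (d 0) ε
  exact_succ : ∀ i, Function.Exact (d (i + 1)) (d i)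
  minimal : ∀ i w a, d i w a ∈ Ideal.span (Set.range (MvPolynomial.X : V → MvPolynomial V K))

/-- The graded Betti number `β i j`: the number of copies of `S(-j)` in the `i`-th free module. -/
def MinimalGradedFreeResolution.betti {V K : Type*} [Field K] {I : Ideal (MvPolynomial V K)}
    (F : MinimalGradedFreeResolution I) (i j : ℕ) : ℕ :=
  (Finset.univ.filter fun a : Fin (F.rank i) => F.deg i a = j).card

/-- `r` is the Castelnuovo–Mumford regularity of the (nonzero, homogeneous) ideal `I`, as a module:
`I` has a minimal graded free resolution, and `r = max {j - i | β i j ≠ 0}`. As all minimal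
graded free resolutions of `I` are isomorphic, it does not matter which one is used. -/
def HasRegularity {V K : Type*} [Field K] (I : Ideal (MvPolynomial V K)) (r : ℤ) : Prop :=
  Nonempty (MinimalGradedFreeResolution I) ∧
    ∀ F : MinimalGradedFreeResolution I,
      IsGreatest {m : ℤ | ∃ i j : ℕ, F.betti i j ≠ 0 ∧ m = (j : ℤ) - (i : ℤ)} r

end SquarefreePowers

/-! The squarefree power is generated by the vertex sets of the `s`-edge matchings, since a
squarefree product of `s` edges uses disjoint edges (`squarefreePower_edgeIdeal_eq`). By symmetry it
suffices to bound its regularity by `X.card + s`.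

For a squarefree monomial ideal `I` and a variable `x`, write `I = I₀ + x I₁`, where `I₀` keeps the
generators avoiding `x` and `I₁` sets `x = 1`. Then `I₀ ∩ x I₁ = x I₀`, whence `reg I ≤ max (reg I₀)
(reg I₁ + 1)`. Doing this for every vertex of `X` leaves one slice for each `σ ⊆ X`, at a cost of
`σ.card` (`regularityLE_squarefreeIdeal_of_slices`). The slice at `σ` is generated by the
`s`-subsets of `Y` that can be matched into `σ`. These satisfy basis exchange
(`IsMatchedInto.exists_exchange`), being the bases of a transversal matroid if there are any, so the
slice has regularity at most `s` (`regularityLE_squarefreeIdeal_of_exchange`), and `s + σ.card ≤ s +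
X.card`.

Regularity is handled without Tor: `SyzygyBound` records degree bounds on finitely many steps of
some graded free resolution, not necessarily minimal. It behaves well in short exact sequences, and
`SyzygyBound.ker` with `SyzygyBound.degree_le` carries the bounds over to any minimal resolution. -/

namespace SquarefreePowers

/-! ### Graded free modules, homogeneous parts and degree-preserving maps. -/

section Graded

variable {V K : Type*} [Field K] {ι κ μ : Type*}

/-- The degree `n` part of a vector of the graded free module `⨁ₐ S(-deg a)`. -/
noncomputable def homogeneousPart (deg : ι → ℕ) (n : ℕ) (w : ι → MvPolynomial V K) :
    ι → MvPolynomial V K :=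
  fun a => if deg a ≤ n then MvPolynomial.homogeneousComponent (n - deg a) (w a) else 0

theorem coeff_homogeneousPart (deg : ι → ℕ) (n : ℕ) (w : ι → MvPolynomial V K) (a : ι)
    (m : V →₀ ℕ) :
    (homogeneousPart deg n w a).coeff m = if m.degree + deg a = n then (w a).coeff m else 0 := by
  unfold homogeneousPart
  by_cases h : deg a ≤ n
  · rw [if_pos h, MvPolynomial.coeff_homogeneousComponent]
    congr 1
    exact propext (by omega)
  · rw [if_neg h, if_neg (by omega), MvPolynomial.coeff_zero]

theorem isHomogeneousVector_homogeneousPart (deg : ι → ℕ) (n : ℕ) (w : ι → MvPolynomial V K) :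
    IsHomogeneousVector deg n (homogeneousPart deg n w) := by
  intro a m hm
  rw [MvPolynomial.mem_support_iff, coeff_homogeneousPart] at hm
  by_contra h
  exact hm (if_neg h)

theorem IsHomogeneousVector.homogeneousPart_eq {deg : ι → ℕ} {n : ℕ} {w : ι → MvPolynomial V K}
    (hw : IsHomogeneousVector deg n w) (k : ℕ) :
    homogeneousPart deg k w = if k = n then w else 0 := by
  funext a
  ext m
  rw [coeff_homogeneousPart]
  by_cases hm : m ∈ (w a).support
  · have := hw a m hm
    by_cases hk : k = n
    · rw [if_pos hk, if_pos (by omega)]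
    · rw [if_neg hk, if_neg (by omega)]; simp
  · rw [MvPolynomial.notMem_support_iff] at hm
    by_cases hk : k = n
    · rw [if_pos hk, hm, ite_self]
    · rw [if_neg hk, hm, ite_self]; simp

theorem homogeneousPart_sum (deg : ι → ℕ) (n : ℕ) {α : Type*} (s : Finset α)
    (f : α → ι → MvPolynomial V K) :
    homogeneousPart deg n (∑ i ∈ s, f i) = ∑ i ∈ s, homogeneousPart deg n (f i) := by
  funext a
  ext m
  rw [coeff_homogeneousPart, Finset.sum_apply, Finset.sum_apply, MvPolynomial.coeff_sum,
    MvPolynomial.coeff_sum]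
  simp_rw [coeff_homogeneousPart]
  split_ifs <;> simp

theorem exists_eq_sum_homogeneousPart [Finite ι] (deg : ι → ℕ) (w : ι → MvPolynomial V K) :
    ∃ N, w = ∑ n ∈ Finset.range N, homogeneousPart deg n w := by
  cases nonempty_fintype ι
  refine ⟨(Finset.univ.sup fun a => (w a).support.sup fun m => m.degree + deg a) + 1, ?_⟩
  funext a
  ext m
  rw [Finset.sum_apply, MvPolynomial.coeff_sum]
  simp_rw [coeff_homogeneousPart]
  rw [Finset.sum_ite_eq]
  by_cases hm : m ∈ (w a).support
  · rw [if_pos]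
    rw [Finset.mem_range, Nat.lt_succ_iff]
    exact (Finset.le_sup (f := fun m => m.degree + deg a) hm).trans
      (Finset.le_sup (f := fun a => (w a).support.sup fun m => m.degree + deg a)
        (Finset.mem_univ a))
  · rw [MvPolynomial.notMem_support_iff.mp hm, ite_self]

theorem IsHomogeneousVector.add {deg : ι → ℕ} {n : ℕ} {v w : ι → MvPolynomial V K}
    (hv : IsHomogeneousVector deg n v) (hw : IsHomogeneousVector deg n w) :
    IsHomogeneousVector deg n (v + w) := by
  classical
  intro a m hm
  rcases Finset.mem_union.mp (MvPolynomial.support_add hm) with h | h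
  exacts [hv a m h, hw a m h]

theorem IsHomogeneousVector.neg {deg : ι → ℕ} {n : ℕ} {v : ι → MvPolynomial V K}
    (hv : IsHomogeneousVector deg n v) : IsHomogeneousVector deg n (-v) := by
  intro a m hm
  rw [Pi.neg_apply, MvPolynomial.support_neg] at hm
  exact hv a m hm

theorem isHomogeneousVector_zero (deg : ι → ℕ) (n : ℕ) :
    IsHomogeneousVector deg n (0 : ι → MvPolynomial V K) := by
  intro a m hm
  simp at hm

theorem IsHomogeneousVector.sum {deg : ι → ℕ} {n : ℕ} {α : Type*} (s : Finset α)
    {f : α → ι → MvPolynomial V K} (hf : ∀ i ∈ s, IsHomogeneousVector deg n (f i)) :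
    IsHomogeneousVector deg n (∑ i ∈ s, f i) :=
  Finset.sum_induction f _ (fun _ _ => IsHomogeneousVector.add) (isHomogeneousVector_zero _ _) hf

theorem IsHomogeneousVector.smul {deg : ι → ℕ} {n k : ℕ} {v : ι → MvPolynomial V K}
    (hv : IsHomogeneousVector deg k v) {p : MvPolynomial V K}
    (hp : ∀ m ∈ p.support, m.degree + k = n) :
    IsHomogeneousVector deg n (p • v) := by
  classical
  intro a m hm
  rw [Pi.smul_apply, smul_eq_mul] at hm
  obtain ⟨m₁, h₁, m₂, h₂, rfl⟩ := Finset.mem_add.mp (MvPolynomial.support_mul _ _ hm)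
  rw [map_add, add_assoc, hv a m₂ h₂, hp m₁ h₁]

theorem isHomogeneousVector_single [DecidableEq ι] (deg : ι → ℕ) (a : ι) :
    IsHomogeneousVector deg (deg a) (Pi.single a (1 : MvPolynomial V K)) := by
  intro b m hm
  by_cases h : b = a
  · subst h
    rw [Pi.single_eq_same, MvPolynomial.support_one, Finset.mem_singleton] at hm
    simp [hm]
  · rw [Pi.single_eq_of_ne h] at hm
    simp at hm

/-- A linear map of graded free modules that preserves degrees. -/
def IsGraded (d : ι → ℕ) (d' : κ → ℕ)
    (φ : (ι → MvPolynomial V K) →ₗ[MvPolynomial V K] (κ → MvPolynomial V K)) : Prop :=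
  ∀ n w, IsHomogeneousVector d n w → IsHomogeneousVector d' n (φ w)

theorem IsGraded.comp {d : ι → ℕ} {d' : κ → ℕ} {d'' : μ → ℕ}
    {ψ : (κ → MvPolynomial V K) →ₗ[MvPolynomial V K] (μ → MvPolynomial V K)}
    {φ : (ι → MvPolynomial V K) →ₗ[MvPolynomial V K] (κ → MvPolynomial V K)}
    (hψ : IsGraded d' d'' ψ) (hφ : IsGraded d d' φ) : IsGraded d d'' (ψ ∘ₗ φ) :=
  fun n w hw => hψ n _ (hφ n w hw)

theorem isGraded_linearCombination [Fintype ι] {d : ι → ℕ} {d' : κ → ℕ}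
    {g : ι → κ → MvPolynomial V K} (hg : ∀ i, IsHomogeneousVector d' (d i) (g i)) :
    IsGraded d d' (Fintype.linearCombination (MvPolynomial V K) g) := by
  intro n w hw
  rw [Fintype.linearCombination_apply]
  exact IsHomogeneousVector.sum _ fun i _ => (hg i).smul (hw i)

theorem IsGraded.map_homogeneousPart [Finite ι] {d : ι → ℕ} {d' : κ → ℕ}
    {φ : (ι → MvPolynomial V K) →ₗ[MvPolynomial V K] (κ → MvPolynomial V K)}
    (hφ : IsGraded d d' φ) (n : ℕ) (w : ι → MvPolynomial V K) :
    φ (homogeneousPart d n w) = homogeneousPart d' n (φ w) := by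
  obtain ⟨N, hN⟩ := exists_eq_sum_homogeneousPart d w
  conv_rhs => rw [hN, map_sum, homogeneousPart_sum]
  conv_lhs => rw [hN, homogeneousPart_sum, map_sum]
  refine Finset.sum_congr rfl fun k _ => ?_
  have hk := isHomogeneousVector_homogeneousPart d k w
  rw [hk.homogeneousPart_eq, (hφ k _ hk).homogeneousPart_eq]
  split_ifs <;> simp

/-- A submodule of a graded free module that contains the homogeneous parts of its elements. -/
def IsHomogeneousSubmodule (d : ι → ℕ)
    (N : Submodule (MvPolynomial V K) (ι → MvPolynomial V K)) : Prop :=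
  ∀ n, ∀ w ∈ N, homogeneousPart d n w ∈ N

theorem homogeneousPart_zero (deg : ι → ℕ) (n : ℕ) :
    homogeneousPart deg n (0 : ι → MvPolynomial V K) = 0 := by
  funext a
  ext m
  simp [coeff_homogeneousPart]

theorem IsGraded.isHomogeneousSubmodule_ker [Finite ι] {d : ι → ℕ} {d' : κ → ℕ}
    {φ : (ι → MvPolynomial V K) →ₗ[MvPolynomial V K] (κ → MvPolynomial V K)}
    (hφ : IsGraded d d' φ) : IsHomogeneousSubmodule d (LinearMap.ker φ) := by
  intro n w hw
  rw [LinearMap.mem_ker] at hw ⊢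
  rw [hφ.map_homogeneousPart, hw, homogeneousPart_zero]

/-- Graded projectivity of free modules: choose a preimage in `B` of the image of each basis vector
and keep only its part of the right degree. -/
theorem IsGraded.exists_lift [Finite ι] [Fintype μ] {d : ι → ℕ} {d' : κ → ℕ} {d'' : μ → ℕ}
    {φ : (ι → MvPolynomial V K) →ₗ[MvPolynomial V K] (κ → MvPolynomial V K)}
    (hφ : IsGraded d d' φ) {B : Submodule (MvPolynomial V K) (ι → MvPolynomial V K)}
    (hB : IsHomogeneousSubmodule d B)
    {ψ : (μ → MvPolynomial V K) →ₗ[MvPolynomial V K] (κ → MvPolynomial V K)}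
    (hψ : IsGraded d'' d' ψ) (hle : LinearMap.range ψ ≤ B.map φ) :
    ∃ s : (μ → MvPolynomial V K) →ₗ[MvPolynomial V K] (ι → MvPolynomial V K),
      IsGraded d'' d s ∧ φ ∘ₗ s = ψ ∧ LinearMap.range s ≤ B := by
  classical
  have h : ∀ k : μ, ∃ b ∈ B, φ b = ψ (Pi.single k 1) ∧ IsHomogeneousVector d (d'' k) b := by
    intro k
    obtain ⟨b, hb, hbk⟩ := hle ⟨Pi.single k 1, rfl⟩
    refine ⟨_, hB (d'' k) b hb, ?_, isHomogeneousVector_homogeneousPart _ _ _⟩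
    rw [hφ.map_homogeneousPart, hbk,
      (hψ _ _ (isHomogeneousVector_single d'' k)).homogeneousPart_eq, if_pos rfl]
  choose b hbB hbφ hbd using h
  refine ⟨Fintype.linearCombination _ b, isGraded_linearCombination hbd, ?_, ?_⟩
  · refine LinearMap.pi_ext' fun k => LinearMap.ext_ring ?_
    simp only [LinearMap.comp_apply, LinearMap.single_apply,
      Fintype.linearCombination_apply_single, one_smul, hbφ]
  · rintro _ ⟨w, rfl⟩
    rw [Fintype.linearCombination_apply]
    exact Submodule.sum_mem _ fun k _ => Submodule.smul_mem _ _ (hbB k)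

end Graded

/-! ### Degree bounds on syzygies: definition and elementary operations. -/

section SyzygyBound

universe u v

variable {V : Type u} {K : Type v} [Field K]

/-- The graded submodule `N` of `⨁ₐ S(-d a)` has a graded free resolution such that the `i`-th
free module is generated in degrees at most `r + i`, for all `i < n`. -/
def SyzygyBound : ℕ → ∀ {ι : Type}, (ι → ℕ) →
    Submodule (MvPolynomial V K) (ι → MvPolynomial V K) → ℤ → Prop
  | 0, _, _, _, _ => True
  | n + 1, ι, d, N, r => ∃ (κ : Type) (_ : Fintype κ) (e : κ → ℕ)
      (φ : (κ → MvPolynomial V K) →ₗ[MvPolynomial V K] (ι → MvPolynomial V K)),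
      (∀ k, (e k : ℤ) ≤ r) ∧ IsGraded e d φ ∧ LinearMap.range φ = N ∧
        SyzygyBound n e (LinearMap.ker φ) (r + 1)

variable {ι κ : Type} {n : ℕ} {r r' : ℤ} {d : ι → ℕ} {e : κ → ℕ}
  {N : Submodule (MvPolynomial V K) (ι → MvPolynomial V K)}

theorem SyzygyBound.mono (h : SyzygyBound n d N r) (hr : r ≤ r') : SyzygyBound n d N r' := by
  induction n generalizing ι r r' with
  | zero => trivial
  | succ n ih =>
    obtain ⟨κ, _, e, φ, he, hφ, hN, h⟩ := h
    exact ⟨κ, inferInstance, e, φ, fun k => (he k).trans hr, hφ, hN, ih h (by omega)⟩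

theorem SyzygyBound.pred (h : SyzygyBound (n + 1) d N r) : SyzygyBound n d N r := by
  induction n generalizing ι r with
  | zero => trivial
  | succ n ih =>
    obtain ⟨κ, _, e, φ, he, hφ, hN, h⟩ := h
    exact ⟨κ, inferInstance, e, φ, he, hφ, hN, ih h⟩

theorem SyzygyBound.shift (h : SyzygyBound n d N r) :
    SyzygyBound n (fun a => d a + 1) N (r + 1) := by
  induction n generalizing ι r with
  | zero => trivial
  | succ n ih =>
    obtain ⟨κ, _, e, φ, he, hφ, hN, h⟩ := h
    refine ⟨κ, inferInstance, fun k => e k + 1, φ,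
      fun k => by have := he k; push_cast; omega, ?_, hN, ih h⟩
    intro m w hw a p hp
    cases m with
    | zero =>
      -- All shifted degrees are positive, so only the zero vector has degree `0`.
      have hw0 : w = 0 := by
        funext k
        ext q
        by_contra hq
        have := hw k q (by simpa using hq)
        exact absurd this (Nat.succ_ne_zero _)
      simp [hw0] at hp
    | succ m =>
      have := hφ m w (fun k q hq => Nat.succ_injective (hw k q hq)) a p hp
      rw [← this, add_assoc]

/-- As `φ` is injective on `N`, composing a cover of `N` with `φ` does not change its kernel; only
the first map of the resolution is replaced. -/
theorem SyzygyBound.map (h : SyzygyBound n d N r)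
    {φ : (ι → MvPolynomial V K) →ₗ[MvPolynomial V K] (κ → MvPolynomial V K)}
    (hφ : IsGraded d e φ) (hinj : Disjoint N (LinearMap.ker φ)) :
    SyzygyBound n e (N.map φ) r := by
  cases n with
  | zero => trivial
  | succ n =>
    obtain ⟨κ, _, e, χ, he, hχ, hN, h⟩ := h
    refine ⟨κ, inferInstance, e, φ ∘ₗ χ, he, hφ.comp hχ, by rw [LinearMap.range_comp, hN], ?_⟩
    convert h using 1
    ext w
    rw [LinearMap.mem_ker, LinearMap.mem_ker, LinearMap.comp_apply]
    refine ⟨fun hw => ?_, fun hw => by rw [hw, map_zero]⟩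
    exact Submodule.disjoint_def.mp hinj _ (hN ▸ ⟨w, rfl⟩) hw

theorem syzygyBound_bot (n : ℕ) (d : ι → ℕ) (r : ℤ) :
    SyzygyBound n d (⊥ : Submodule (MvPolynomial V K) (ι → MvPolynomial V K)) r := by
  induction n generalizing ι r with
  | zero => trivial
  | succ n ih =>
    refine ⟨Empty, inferInstance, fun _ => 0, 0, fun k => k.elim,
      fun m w _ => isHomogeneousVector_zero d m, LinearMap.range_zero, ?_⟩
    convert ih (ι := Empty) (fun _ => 0) (r + 1)
    exact Subsingleton.elim _ _

theorem syzygyBound_top [Fintype ι] (n : ℕ) {d : ι → ℕ} (hd : ∀ i, (d i : ℤ) ≤ r) :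
    SyzygyBound n d (⊤ : Submodule (MvPolynomial V K) (ι → MvPolynomial V K)) r := by
  cases n with
  | zero => trivial
  | succ n =>
    refine ⟨ι, inferInstance, d, LinearMap.id, hd, fun _ _ h => h, LinearMap.range_id, ?_⟩
    rw [LinearMap.ker_id]
    exact syzygyBound_bot n d _

end SyzygyBound

/-! ### Maps into and out of direct sums of graded free modules. -/

section Sum

variable {V K : Type*} [Field K] {ι κ μ : Type*}

theorem IsGraded.add {d : ι → ℕ} {d' : κ → ℕ}
    {φ ψ : (ι → MvPolynomial V K) →ₗ[MvPolynomial V K] (κ → MvPolynomial V K)}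
    (hφ : IsGraded d d' φ) (hψ : IsGraded d d' ψ) : IsGraded d d' (φ + ψ) :=
  fun n w hw => (hφ n w hw).add (hψ n w hw)

theorem IsGraded.neg {d : ι → ℕ} {d' : κ → ℕ}
    {φ : (ι → MvPolynomial V K) →ₗ[MvPolynomial V K] (κ → MvPolynomial V K)}
    (hφ : IsGraded d d' φ) : IsGraded d d' (-φ) :=
  fun n w hw => (hφ n w hw).neg

theorem isGraded_funLeft_inl (d : ι → ℕ) (d' : κ → ℕ) :
    IsGraded (Sum.elim d d') d
      (LinearMap.funLeft (MvPolynomial V K) (MvPolynomial V K) (Sum.inl : ι → ι ⊕ κ)) :=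
  fun _ _ hw a m hm => hw (Sum.inl a) m hm

theorem isGraded_funLeft_inr (d : ι → ℕ) (d' : κ → ℕ) :
    IsGraded (Sum.elim d d') d'
      (LinearMap.funLeft (MvPolynomial V K) (MvPolynomial V K) (Sum.inr : κ → ι ⊕ κ)) :=
  fun _ _ hw a m hm => hw (Sum.inr a) m hm

/-- The map into a direct sum of free modules with the given components. -/
noncomputable def sumLift
    (φ : (μ → MvPolynomial V K) →ₗ[MvPolynomial V K] (ι → MvPolynomial V K))
    (ψ : (μ → MvPolynomial V K) →ₗ[MvPolynomial V K] (κ → MvPolynomial V K)) :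
    (μ → MvPolynomial V K) →ₗ[MvPolynomial V K] (ι ⊕ κ → MvPolynomial V K) :=
  (LinearEquiv.sumArrowLequivProdArrow ι κ _ _).symm.toLinearMap ∘ₗ φ.prod ψ

theorem sumLift_apply
    (φ : (μ → MvPolynomial V K) →ₗ[MvPolynomial V K] (ι → MvPolynomial V K))
    (ψ : (μ → MvPolynomial V K) →ₗ[MvPolynomial V K] (κ → MvPolynomial V K))
    (w : μ → MvPolynomial V K) : sumLift φ ψ w = Sum.elim (φ w) (ψ w) := by
  funext a
  cases a <;> rfl

theorem IsGraded.sumLift {c : μ → ℕ} {d : ι → ℕ} {d' : κ → ℕ}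
    {φ : (μ → MvPolynomial V K) →ₗ[MvPolynomial V K] (ι → MvPolynomial V K)}
    {ψ : (μ → MvPolynomial V K) →ₗ[MvPolynomial V K] (κ → MvPolynomial V K)}
    (hφ : IsGraded c d φ) (hψ : IsGraded c d' ψ) :
    IsGraded c (Sum.elim d d') (SquarefreePowers.sumLift φ ψ) := by
  intro n w hw a m hm
  rw [sumLift_apply] at hm
  cases a with
  | inl a => exact hφ n w hw a m hm
  | inr a => exact hψ n w hw a m hm

end Sum

/-! ### Degree bounds in short exact sequences, and independence of the cover. -/

section SyzygyBound

universe u v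

variable {V : Type u} {K : Type v} [Field K]
variable {ι κ : Type} {n : ℕ} {r r' : ℤ} {d : ι → ℕ} {e : κ → ℕ}

/-- The horseshoe lemma for `0 → B ∩ ker φ → B → φ(B) → 0`: a cover of the kernel and a lifted cover
of the image together cover `B`, and the kernel of this cover is again an extension of the two
syzygy modules. -/
theorem SyzygyBound.ext [Finite ι]
    {B : Submodule (MvPolynomial V K) (ι → MvPolynomial V K)} (hB : IsHomogeneousSubmodule d B)
    {φ : (ι → MvPolynomial V K) →ₗ[MvPolynomial V K] (κ → MvPolynomial V K)}
    (hφ : IsGraded d e φ) (hA : SyzygyBound n d (B ⊓ LinearMap.ker φ) r)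
    (hC : SyzygyBound n e (B.map φ) r) : SyzygyBound n d B r := by
  induction n generalizing ι κ r with
  | zero => trivial
  | succ n ih =>
    obtain ⟨α, _, a, χ, ha, hχ, hχN, hA⟩ := hA
    obtain ⟨γ, _, c, ψ, hc, hψ, hψN, hC⟩ := hC
    obtain ⟨s, hs, hφs, hsB⟩ := hφ.exists_lift hB hψ hψN.le
    have hχB : ∀ w, χ w ∈ B ∧ φ (χ w) = 0 := fun w => by
      have : χ w ∈ B ⊓ LinearMap.ker φ := hχN ▸ ⟨w, rfl⟩
      exact this
    have hφs' : ∀ w, φ (s w) = ψ w := fun w => LinearMap.congr_fun hφs w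
    let pα := LinearMap.funLeft (MvPolynomial V K) (MvPolynomial V K) (Sum.inl : α → α ⊕ γ)
    let pγ := LinearMap.funLeft (MvPolynomial V K) (MvPolynomial V K) (Sum.inr : γ → α ⊕ γ)
    have hg : IsGraded (Sum.elim a c) d (χ ∘ₗ pα + s ∘ₗ pγ) :=
      (hχ.comp (isGraded_funLeft_inl a c)).add (hs.comp (isGraded_funLeft_inr a c))
    refine ⟨α ⊕ γ, inferInstance, Sum.elim a c, χ ∘ₗ pα + s ∘ₗ pγ, ?_, hg, ?_, ?_⟩
    · rintro (k | k)
      exacts [ha k, hc k]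
    · apply le_antisymm
      · rintro _ ⟨w, rfl⟩
        exact B.add_mem (hχB _).1 (hsB ⟨_, rfl⟩)
      · intro b hb
        obtain ⟨v, hv⟩ : φ b ∈ LinearMap.range ψ := hψN ▸ ⟨b, hb, rfl⟩
        obtain ⟨u, hu⟩ : b - s v ∈ LinearMap.range χ := by
          rw [hχN]
          exact ⟨B.sub_mem hb (hsB ⟨v, rfl⟩),
            by rw [SetLike.mem_coe, LinearMap.mem_ker, map_sub, hφs', hv, sub_self]⟩
        refine ⟨Sum.elim u v, ?_⟩
        change χ u + s v = b
        rw [hu, sub_add_cancel]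
    · refine ih hg.isHomogeneousSubmodule_ker (isGraded_funLeft_inr a c) ?_ ?_
      · convert hA.map (φ := sumLift LinearMap.id 0) (e := Sum.elim a c)
          (IsGraded.sumLift (fun _ _ h => h) fun m _ _ => isHomogeneousVector_zero c m) ?_ using 1
        · ext w
          constructor
          · rintro ⟨h₁, h₂⟩
            have h₂' : pγ w = 0 := h₂
            have h₁' : χ (pα w) + s (pγ w) = 0 := h₁
            rw [h₂', map_zero, add_zero] at h₁'
            refine ⟨pα w, h₁', ?_⟩
            rw [sumLift_apply]
            funext k
            rcases k with k | k
            · rfl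
            · exact (congr_fun h₂' k).symm
          · rintro ⟨u, hu, rfl⟩
            rw [sumLift_apply]
            refine ⟨?_, rfl⟩
            change χ u + s 0 = 0
            rw [map_zero, add_zero, LinearMap.mem_ker.mp hu]
        · rw [Submodule.disjoint_def]
          intro w _ hw
          rw [LinearMap.mem_ker, sumLift_apply] at hw
          funext k
          exact congr_fun hw (Sum.inl k)
      · convert hC using 1
        ext v
        constructor
        · rintro ⟨w, hw, rfl⟩
          have hw' : χ (pα w) + s (pγ w) = 0 := hw
          have := congr_arg φ hw'
          rwa [map_add, (hχB _).2, zero_add, map_zero, hφs'] at this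
        · intro hv
          obtain ⟨u, hu⟩ : -s v ∈ LinearMap.range χ := by
            rw [hχN]
            exact ⟨B.neg_mem (hsB ⟨v, rfl⟩), by
              rw [SetLike.mem_coe, LinearMap.mem_ker, map_neg, hφs', LinearMap.mem_ker.mp hv, neg_zero]⟩
          refine ⟨Sum.elim u v, ?_, rfl⟩
          change χ u + s v = 0
          rw [hu, neg_add_cancel]

/-- Bounds the quotient in a short exact sequence. Composing a cover of `B` with `φ` covers `φ(B)`,
and the kernel is an extension of `B ∩ ker φ` by the syzygies of `B`; hence the kernel may have the
weaker bound `r + 1` and one step fewer. -/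
theorem SyzygyBound.map_of_ker [Finite ι]
    {B : Submodule (MvPolynomial V K) (ι → MvPolynomial V K)}
    {φ : (ι → MvPolynomial V K) →ₗ[MvPolynomial V K] (κ → MvPolynomial V K)}
    (hφ : IsGraded d e φ) (hB : SyzygyBound (n + 1) d B r)
    (hA : SyzygyBound n d (B ⊓ LinearMap.ker φ) (r + 1)) :
    SyzygyBound (n + 1) e (B.map φ) r := by
  obtain ⟨β, _, b, χ, hb, hχ, hχN, hB⟩ := hB
  refine ⟨β, inferInstance, b, φ ∘ₗ χ, hb, hφ.comp hχ, by rw [LinearMap.range_comp, hχN], ?_⟩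
  refine SyzygyBound.ext (hφ.comp hχ).isHomogeneousSubmodule_ker hχ ?_ ?_
  · rwa [inf_eq_right.mpr]
    intro w hw
    rw [LinearMap.mem_ker] at hw ⊢
    rw [LinearMap.comp_apply, hw, map_zero]
  · convert hA using 1
    rw [LinearMap.ker_comp, Submodule.map_comap_eq, hχN]

theorem SyzygyBound.prod [Finite ι] [Finite κ]
    {A : Submodule (MvPolynomial V K) (ι → MvPolynomial V K)}
    {C : Submodule (MvPolynomial V K) (κ → MvPolynomial V K)}
    (hA : IsHomogeneousSubmodule d A) (hC : IsHomogeneousSubmodule e C)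
    (hAn : SyzygyBound n d A r) (hCn : SyzygyBound n e C r) :
    SyzygyBound n (Sum.elim d e)
      (A.comap (LinearMap.funLeft _ (MvPolynomial V K) (Sum.inl : ι → ι ⊕ κ)) ⊓
        C.comap (LinearMap.funLeft _ (MvPolynomial V K) (Sum.inr : κ → ι ⊕ κ))) r := by
  refine SyzygyBound.ext ?_ (isGraded_funLeft_inr d e) ?_ ?_
  · rintro m w ⟨h₁, h₂⟩
    exact ⟨hA m _ h₁, hC m _ h₂⟩
  · convert hAn.map (φ := sumLift LinearMap.id 0) (e := Sum.elim d e)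
      (IsGraded.sumLift (fun _ _ h => h) fun m _ _ => isHomogeneousVector_zero e m) ?_ using 1
    · ext w
      constructor
      · rintro ⟨⟨h₁, _⟩, h₂⟩
        refine ⟨_, h₁, ?_⟩
        rw [sumLift_apply]
        funext k
        rcases k with k | k
        · rfl
        · exact (congr_fun h₂ k).symm
      · rintro ⟨u, hu, rfl⟩
        rw [sumLift_apply]
        exact ⟨⟨hu, C.zero_mem⟩, rfl⟩
    · rw [Submodule.disjoint_def]
      intro w _ hw
      rw [LinearMap.mem_ker, sumLift_apply] at hw
      funext k
      exact congr_fun hw (Sum.inl k)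
  · convert hCn using 1
    ext v
    constructor
    · rintro ⟨w, ⟨_, h⟩, rfl⟩
      exact h
    · intro hv
      exact ⟨Sum.elim 0 v, ⟨A.zero_mem, hv⟩, rfl⟩

/-- Mayer–Vietoris: addition maps `A ⊕ C` onto `A + C`, with kernel the antidiagonal copy of `A ∩
C`. -/
theorem SyzygyBound.sup [Finite ι]
    {A C : Submodule (MvPolynomial V K) (ι → MvPolynomial V K)}
    (hA : IsHomogeneousSubmodule d A) (hC : IsHomogeneousSubmodule d C)
    (hAn : SyzygyBound (n + 1) d A r) (hCn : SyzygyBound (n + 1) d C r)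
    (hI : SyzygyBound n d (A ⊓ C) (r + 1)) :
    SyzygyBound (n + 1) d (A ⊔ C) r := by
  let p₁ := LinearMap.funLeft (MvPolynomial V K) (MvPolynomial V K) (Sum.inl : ι → ι ⊕ ι)
  let p₂ := LinearMap.funLeft (MvPolynomial V K) (MvPolynomial V K) (Sum.inr : ι → ι ⊕ ι)
  have hg : IsGraded (Sum.elim d d) d (p₁ + p₂) :=
    (isGraded_funLeft_inl d d).add (isGraded_funLeft_inr d d)
  have h := (SyzygyBound.prod hA hC hAn hCn).map_of_ker hg ?_
  · convert h using 1
    ext w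
    rw [Submodule.mem_sup]
    constructor
    · rintro ⟨a, ha, c, hc, rfl⟩
      exact ⟨Sum.elim a c, ⟨ha, hc⟩, rfl⟩
    · rintro ⟨w, ⟨h₁, h₂⟩, rfl⟩
      exact ⟨_, h₁, _, h₂, rfl⟩
  · convert hI.map (φ := sumLift LinearMap.id (-LinearMap.id)) (e := Sum.elim d d)
      (IsGraded.sumLift (fun _ _ h => h) (IsGraded.neg fun _ _ h => h)) ?_ using 1
    · ext w
      constructor
      · rintro ⟨⟨h₁, h₂⟩, h⟩
        have h' : p₁ w + p₂ w = 0 := h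
        have h₁' : p₁ w ∈ A := h₁
        have h₂' : p₂ w ∈ C := h₂
        refine ⟨p₁ w, ⟨h₁, ?_⟩, ?_⟩
        · rw [eq_neg_of_add_eq_zero_left h']
          exact C.neg_mem h₂'
        · rw [sumLift_apply]
          funext k
          rcases k with k | k
          · rfl
          · exact congr_fun (neg_eq_of_add_eq_zero_right h') k
      · rintro ⟨u, ⟨h₁, h₂⟩, rfl⟩
        rw [sumLift_apply]
        exact ⟨⟨h₁, C.neg_mem h₂⟩, add_neg_cancel u⟩
    · rw [Submodule.disjoint_def]
      intro w _ hw
      rw [LinearMap.mem_ker, sumLift_apply] at hw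
      funext k
      exact congr_fun hw (Sum.inl k)

/-- A Schanuel argument, making the bound independent of the cover. The pullback `P` of the covers
`χ` and `φ` is an extension of a free module by `ker χ`. If `s` lifts `χ` through `φ`, then `(u, v)
↦ v - s u` maps `P` onto `ker φ`, and its kernel is the graph of `s`, which is free. -/
theorem SyzygyBound.ker [Fintype κ]
    {N : Submodule (MvPolynomial V K) (ι → MvPolynomial V K)} (hN : SyzygyBound (n + 1) d N r)
    {φ : (κ → MvPolynomial V K) →ₗ[MvPolynomial V K] (ι → MvPolynomial V K)}
    (hφ : IsGraded e d φ) (hφN : LinearMap.range φ = N) (he : ∀ k, (e k : ℤ) ≤ r) :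
    SyzygyBound n e (LinearMap.ker φ) (r + 1) := by
  obtain ⟨β, _, b, χ, hb, hχ, hχN, hK⟩ := hN
  cases n with
  | zero => trivial
  | succ n =>
    obtain ⟨s, hs, hφs, -⟩ := hφ.exists_lift (B := ⊤) (fun _ _ _ => trivial) hχ
      (by rw [hχN, ← hφN, LinearMap.range_eq_map])
    have hφs' : ∀ w, φ (s w) = χ w := fun w => LinearMap.congr_fun hφs w
    let p₁ := LinearMap.funLeft (MvPolynomial V K) (MvPolynomial V K) (Sum.inl : β → β ⊕ κ)
    let p₂ := LinearMap.funLeft (MvPolynomial V K) (MvPolynomial V K) (Sum.inr : κ → β ⊕ κ)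
    have hp₁ : IsGraded (Sum.elim b e) b p₁ := isGraded_funLeft_inl b e
    have hp₂ : IsGraded (Sum.elim b e) e p₂ := isGraded_funLeft_inr b e
    let P := LinearMap.ker (χ ∘ₗ p₁ + -(φ ∘ₗ p₂))
    have hP : ∀ w, w ∈ P ↔ χ (p₁ w) = φ (p₂ w) := fun w => by
      rw [← sub_eq_zero, sub_eq_add_neg]
      rfl
    have hPn : SyzygyBound (n + 1) (Sum.elim b e) P (r + 1) := by
      refine SyzygyBound.ext
        ((hχ.comp hp₁).add (hφ.comp hp₂).neg).isHomogeneousSubmodule_ker hp₂ ?_ ?_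
      · convert hK.map (φ := sumLift LinearMap.id 0) (e := Sum.elim b e)
          (IsGraded.sumLift (fun _ _ h => h) fun m _ _ => isHomogeneousVector_zero e m) ?_ using 1
        · ext w
          constructor
          · rintro ⟨h₁, h₂⟩
            have h₂' : p₂ w = 0 := h₂
            have h₁' := (hP w).mp h₁
            rw [h₂', map_zero] at h₁'
            refine ⟨p₁ w, h₁', ?_⟩
            rw [sumLift_apply]
            funext k
            rcases k with k | k
            · rfl
            · exact (congr_fun h₂' k).symm
          · rintro ⟨u, hu, rfl⟩
            rw [sumLift_apply]
            refine ⟨(hP _).mpr ?_, rfl⟩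
            change χ u = φ 0
            rw [map_zero, LinearMap.mem_ker.mp hu]
        · rw [Submodule.disjoint_def]
          intro w _ hw
          rw [LinearMap.mem_ker, sumLift_apply] at hw
          funext k
          exact congr_fun hw (Sum.inl k)
      · convert syzygyBound_top (V := V) (K := K) (n + 1) (d := e) (r := r + 1)
          (fun k => (he k).trans (by omega)) using 1
        rw [eq_top_iff]
        intro v _
        obtain ⟨u, hu⟩ : φ v ∈ LinearMap.range χ := by
          rw [hχN, ← hφN]
          exact ⟨v, rfl⟩
        exact ⟨Sum.elim u v, (hP _).mpr hu, rfl⟩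
    have hθ : IsGraded (Sum.elim b e) e (p₂ + -(s ∘ₗ p₁)) := hp₂.add (hs.comp hp₁).neg
    have hθ' : ∀ w, (p₂ + -(s ∘ₗ p₁)) w = p₂ w - s (p₁ w) := fun w => (sub_eq_add_neg _ _).symm
    convert hPn.map_of_ker hθ ?_ using 1
    · ext v
      constructor
      · intro hv
        refine ⟨Sum.elim 0 v, (hP _).mpr ?_, ?_⟩
        · change χ 0 = φ v
          rw [map_zero, LinearMap.mem_ker.mp hv]
        · rw [hθ']
          change v - s 0 = v
          rw [map_zero, sub_zero]
      · rintro ⟨w, hw, rfl⟩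
        rw [LinearMap.mem_ker, hθ', map_sub, hφs', (hP w).mp hw, sub_self]
    · convert (syzygyBound_top (V := V) (K := K) n (d := b) (r := r + 1 + 1)
        (fun k => (hb k).trans (by omega))).map (φ := sumLift LinearMap.id s) (e := Sum.elim b e)
        (IsGraded.sumLift (fun _ _ h => h) hs) ?_ using 1
      · ext w
        constructor
        · rintro ⟨_, h₂⟩
          rw [SetLike.mem_coe, LinearMap.mem_ker, hθ', sub_eq_zero] at h₂
          refine ⟨p₁ w, trivial, ?_⟩
          rw [sumLift_apply]
          funext k
          rcases k with k | k
          · rfl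
          · exact (congr_fun h₂ k).symm
        · rintro ⟨u, -, rfl⟩
          rw [sumLift_apply]
          refine ⟨(hP _).mpr (hφs' u).symm, ?_⟩
          rw [SetLike.mem_coe, LinearMap.mem_ker, hθ', sub_eq_zero]
          rfl
      · rw [Submodule.disjoint_def]
        intro w _ hw
        rw [LinearMap.mem_ker, sumLift_apply] at hw
        funext k
        exact congr_fun hw (Sum.inl k)

end SyzygyBound

/-! ### Regularity bounds versus minimal graded free resolutions. -/

section Resolution

universe u v

variable {V : Type u} {K : Type v} [Field K]
variable {ι κ : Type}

theorem coeff_zero_of_mem_span_range_X {p : MvPolynomial V K}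
    (hp : p ∈ Ideal.span (Set.range (MvPolynomial.X : V → MvPolynomial V K))) : p.coeff 0 = 0 := by
  rw [← pow_one (Ideal.span _)] at hp
  exact (MvPolynomial.mem_pow_idealOfVars_iff' 1 p).mp hp 0 (by simp)

theorem mem_span_range_X_of_coeff_zero {p : MvPolynomial V K} (hp : p.coeff 0 = 0) :
    p ∈ Ideal.span (Set.range (MvPolynomial.X : V → MvPolynomial V K)) := by
  rw [← pow_one (Ideal.span _)]
  refine (MvPolynomial.mem_pow_idealOfVars_iff' 1 p).mpr fun x hx => ?_
  rwa [(Finsupp.degree_eq_zero_iff x).mp (by omega)]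

theorem isGraded_of_single [Fintype ι] [DecidableEq ι] {d : ι → ℕ} {e : κ → ℕ}
    {φ : (ι → MvPolynomial V K) →ₗ[MvPolynomial V K] (κ → MvPolynomial V K)}
    (h : ∀ a, IsHomogeneousVector e (d a) (φ (Pi.single a 1))) : IsGraded d e φ := by
  have hφ : φ = Fintype.linearCombination (MvPolynomial V K) fun a => φ (Pi.single a 1) := by
    refine LinearMap.pi_ext' fun k => LinearMap.ext_ring ?_
    simp only [LinearMap.comp_apply, LinearMap.single_apply,
      Fintype.linearCombination_apply_single, one_smul]
  rw [hφ]
  exact isGraded_linearCombination h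

/-- A lift through `φ` of a cover generated in degrees at most `r` cannot involve a basis vector of
degree above `r`. Such a vector would be redundant: subtracting a lifted combination gives a
relation with coordinate `1` there, against minimality. -/
theorem SyzygyBound.degree_le [Finite κ] {d : ι → ℕ} {e : κ → ℕ} {r : ℤ}
    {N : Submodule (MvPolynomial V K) (ι → MvPolynomial V K)} (hN : SyzygyBound 1 d N r)
    {φ : (κ → MvPolynomial V K) →ₗ[MvPolynomial V K] (ι → MvPolynomial V K)}
    (hφ : IsGraded e d φ) (hφN : LinearMap.range φ = N)
    (hmin : ∀ w ∈ LinearMap.ker φ, ∀ k,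
      w k ∈ Ideal.span (Set.range (MvPolynomial.X : V → MvPolynomial V K))) (k : κ) :
    (e k : ℤ) ≤ r := by
  classical
  obtain ⟨β, _, b, χ, hb, hχ, hχN, -⟩ := hN
  obtain ⟨s, hs, hφs, -⟩ := hφ.exists_lift (B := ⊤) (fun _ _ _ => trivial) hχ
    (by rw [hχN, ← hφN, LinearMap.range_eq_map])
  by_contra! hk
  have hsk : LinearMap.proj k ∘ₗ s = 0 := by
    refine LinearMap.pi_ext' fun j => LinearMap.ext_ring ?_
    simp only [LinearMap.comp_apply, LinearMap.single_apply, LinearMap.proj_apply,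
      LinearMap.zero_apply]
    by_contra h
    obtain ⟨m, hm⟩ := MvPolynomial.ne_zero_iff.mp h
    have := hs _ _ (isHomogeneousVector_single b j) k m (MvPolynomial.mem_support_iff.mpr hm)
    have := hb j
    omega
  obtain ⟨u, hu⟩ : φ (Pi.single k 1) ∈ LinearMap.range χ := by
    rw [hχN, ← hφN]
    exact ⟨_, rfl⟩
  have h1 : (Pi.single k 1 - s u) ∈ LinearMap.ker φ := by
    rw [LinearMap.mem_ker, map_sub, ← hu, ← hφs, LinearMap.comp_apply, sub_self]
  have h2 : s u k = 0 := LinearMap.congr_fun hsk u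
  have h3 := coeff_zero_of_mem_span_range_X (hmin _ h1 k)
  rw [Pi.sub_apply, h2, Pi.single_eq_same, sub_zero, MvPolynomial.coeff_zero_one] at h3
  exact one_ne_zero h3

/-- An ideal, as a submodule of the free module of rank one. -/
noncomputable def idealSubmodule (I : Ideal (MvPolynomial V K)) :
    Submodule (MvPolynomial V K) (Unit → MvPolynomial V K) :=
  Submodule.comap (LinearMap.proj ()) I

/-- The regularity of `I` is at most `r`: for every `n`, the first `n` steps of a graded free
resolution of `I` can be chosen with the `i`-th free module generated in degrees at most `r + i`. -/
def RegularityLE (I : Ideal (MvPolynomial V K)) (r : ℤ) : Prop :=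
  ∀ n, SyzygyBound n (fun _ => 0) (idealSubmodule I) r

namespace MinimalGradedFreeResolution

variable {I : Ideal (MvPolynomial V K)} (F : MinimalGradedFreeResolution I)

/-- The augmentation with values in the free module of rank one. -/
noncomputable def augmentation : (Fin (F.rank 0) → MvPolynomial V K) →ₗ[MvPolynomial V K]
    (Unit → MvPolynomial V K) :=
  LinearMap.pi fun _ => F.ε

theorem isGraded_augmentation : IsGraded (F.deg 0) (fun _ => 0) F.augmentation := by
  refine isGraded_of_single fun a u m hm => ?_
  have := F.ε_homogeneous a (MvPolynomial.mem_support_iff.mp hm)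
  rwa [Finsupp.degree_eq_weight_one]

theorem range_augmentation : LinearMap.range F.augmentation = idealSubmodule I := by
  ext w
  refine Iff.trans ?_ (SetLike.ext_iff.mp F.range_ε (w ()))
  constructor
  · rintro ⟨u, rfl⟩
    exact ⟨u, rfl⟩
  · rintro ⟨u, hu⟩
    exact ⟨u, funext fun _ => hu⟩

theorem ker_augmentation : LinearMap.ker F.augmentation = LinearMap.range (F.d 0) := by
  ext w
  rw [LinearMap.mem_range]
  refine Iff.trans ?_ (F.exact_zero w)
  exact ⟨fun h => congr_fun h (), fun h => funext fun _ => h⟩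

theorem ker_d (i : ℕ) : LinearMap.ker (F.d i) = LinearMap.range (F.d (i + 1)) := by
  ext w
  exact F.exact_succ i w

theorem isGraded_d (i : ℕ) : IsGraded (F.deg (i + 1)) (F.deg i) (F.d i) :=
  isGraded_of_single (F.d_homogeneous i)

theorem mem_of_mem_range_d (i : ℕ) {w : Fin (F.rank i) → MvPolynomial V K}
    (hw : w ∈ LinearMap.range (F.d i)) (a : Fin (F.rank i)) :
    w a ∈ Ideal.span (Set.range (MvPolynomial.X : V → MvPolynomial V K)) := by
  obtain ⟨u, rfl⟩ := hw
  exact F.minimal i u a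

theorem deg_le_of_regularityLE {r : ℤ} (h : RegularityLE I r) (i : ℕ) (a : Fin (F.rank i)) :
    (F.deg i a : ℤ) ≤ r + i := by
  have h0 : ∀ a, (F.deg 0 a : ℤ) ≤ r := (h 1).degree_le F.isGraded_augmentation
    F.range_augmentation fun w hw => F.mem_of_mem_range_d 0 (F.ker_augmentation ▸ hw)
  -- The bound is carried for all `n` at once because each passage to the next syzygy module uses up
  -- one step.
  have key : ∀ i, (∀ a, (F.deg i a : ℤ) ≤ r + i) ∧
      ∀ n, SyzygyBound n (F.deg i) (LinearMap.range (F.d i)) (r + i + 1) := by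
    intro i
    induction i with
    | zero =>
      simp only [Nat.cast_zero, add_zero]
      refine ⟨h0, fun n => ?_⟩
      rw [← F.ker_augmentation]
      exact (h (n + 1)).ker F.isGraded_augmentation F.range_augmentation h0
    | succ i ih =>
      have h1 : ∀ a, (F.deg (i + 1) a : ℤ) ≤ r + i + 1 := (ih.2 1).degree_le (F.isGraded_d i) rfl
        fun w hw => F.mem_of_mem_range_d (i + 1) (F.ker_d i ▸ hw)
      rw [Nat.cast_succ, ← add_assoc]
      refine ⟨h1, fun n => ?_⟩
      rw [← F.ker_d]
      exact (ih.2 (n + 1)).ker (F.isGraded_d i) rfl h1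
  exact (key i).1 a

theorem regularityLE_of_deg_le {r : ℤ} (h : ∀ i a, (F.deg i a : ℤ) ≤ r + i) :
    RegularityLE I r := by
  have key : ∀ n i, SyzygyBound n (F.deg i) (LinearMap.range (F.d i)) (r + i + 1) := by
    intro n
    induction n with
    | zero => exact fun _ => trivial
    | succ n ih =>
      intro i
      refine ⟨_, inferInstance, F.deg (i + 1), F.d i, fun a => ?_, F.isGraded_d i, rfl, ?_⟩
      · have := h (i + 1) a
        push_cast at this
        omega
      · rw [F.ker_d]
        have := ih (i + 1)
        rwa [Nat.cast_succ, ← add_assoc] at this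
  intro n
  cases n with
  | zero => trivial
  | succ n =>
    refine ⟨_, inferInstance, F.deg 0, F.augmentation, fun a => by simpa using h 0 a,
      F.isGraded_augmentation, F.range_augmentation, ?_⟩
    rw [F.ker_augmentation]
    simpa using key n 0

theorem exists_betti_ne_zero (hI : I ≠ ⊥) : ∃ i j, F.betti i j ≠ 0 := by
  by_contra! h
  have : IsEmpty (Fin (F.rank 0)) := by
    refine ⟨fun a => ?_⟩
    have := h 0 (F.deg 0 a)
    rw [betti, Finset.card_eq_zero, Finset.filter_eq_empty_iff] at this
    exact this (Finset.mem_univ a) rfl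
  apply hI
  rw [← F.range_ε, LinearMap.range_eq_bot]
  exact Subsingleton.elim _ _

theorem betti_ne_zero_iff (i j : ℕ) : F.betti i j ≠ 0 ↔ ∃ a, F.deg i a = j := by
  rw [betti, Finset.card_ne_zero, Finset.filter_nonempty_iff]
  simp

end MinimalGradedFreeResolution

/-- For every minimal resolution the maximum of `j - i` is the least `r` with `RegularityLE I r`.
The latter does not mention the resolution, so all the maxima agree. -/
theorem exists_hasRegularity {I : Ideal (MvPolynomial V K)} (hI : I ≠ ⊥)
    (hF : Nonempty (MinimalGradedFreeResolution I)) {b : ℤ} (hb : RegularityLE I b) :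
    ∃ r, HasRegularity I r ∧ ∀ b, RegularityLE I b → r ≤ b := by
  have hgr : ∀ F : MinimalGradedFreeResolution I, ∃ r,
      IsGreatest {m : ℤ | ∃ i j : ℕ, F.betti i j ≠ 0 ∧ m = (j : ℤ) - (i : ℤ)} r := by
    intro F
    obtain ⟨i, j, hij⟩ := F.exists_betti_ne_zero hI
    refine (Int.exists_greatest_of_bdd (P := fun m => ∃ i j : ℕ, F.betti i j ≠ 0 ∧
      m = (j : ℤ) - (i : ℤ)) ⟨b, ?_⟩ ⟨_, i, j, hij, rfl⟩).imp fun r hr => ⟨hr.1, hr.2⟩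
    rintro m ⟨i, j, hij, rfl⟩
    obtain ⟨a, rfl⟩ := (F.betti_ne_zero_iff i j).mp hij
    have := F.deg_le_of_regularityLE hb i a
    omega
  have hle : ∀ F : MinimalGradedFreeResolution I, ∀ r,
      IsGreatest {m : ℤ | ∃ i j : ℕ, F.betti i j ≠ 0 ∧ m = (j : ℤ) - (i : ℤ)} r →
      RegularityLE I r ∧ ∀ b, RegularityLE I b → r ≤ b := by
    intro F r hr
    constructor
    · refine F.regularityLE_of_deg_le fun i a => ?_
      have := hr.2 ⟨i, _, (F.betti_ne_zero_iff i _).mpr ⟨a, rfl⟩, rfl⟩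
      omega
    · intro b hb
      obtain ⟨i, j, hij, rfl⟩ := hr.1
      obtain ⟨a, rfl⟩ := (F.betti_ne_zero_iff i j).mp hij
      have := F.deg_le_of_regularityLE hb i a
      omega
  obtain ⟨F⟩ := hF
  obtain ⟨r, hr⟩ := hgr F
  refine ⟨r, ⟨⟨F⟩, fun F' => ?_⟩, (hle F r hr).2⟩
  obtain ⟨r', hr'⟩ := hgr F'
  rwa [le_antisymm ((hle F r hr).2 r' (hle F' r' hr').1) ((hle F' r' hr').2 r (hle F r hr).1)]

/-! ### Existence of minimal graded free resolutions. -/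

theorem exists_finset_homogeneous_span [Finite V] [Finite ι] {d : ι → ℕ}
    {N : Submodule (MvPolynomial V K) (ι → MvPolynomial V K)} (hN : IsHomogeneousSubmodule d N) :
    ∃ T : Finset (ι → MvPolynomial V K), (∀ w ∈ T, ∃ n, IsHomogeneousVector d n w) ∧
      Submodule.span (MvPolynomial V K) (T : Set (ι → MvPolynomial V K)) = N := by
  have hspan : Submodule.span (MvPolynomial V K) {w | w ∈ N ∧ ∃ n, IsHomogeneousVector d n w} =
      N := by
    refine le_antisymm (Submodule.span_le.mpr fun w hw => hw.1) fun w hw => ?_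
    obtain ⟨k, hk⟩ := exists_eq_sum_homogeneousPart d w
    rw [hk]
    exact Submodule.sum_mem _ fun n _ => Submodule.subset_span
      ⟨hN n w hw, n, isHomogeneousVector_homogeneousPart d n w⟩
  obtain ⟨T, hT, hTs⟩ := (Submodule.fg_span_iff_fg_span_finset_subset _).mp
    (IsNoetherian.noetherian (Submodule.span (MvPolynomial V K)
      {w | w ∈ N ∧ ∃ n, IsHomogeneousVector d n w}))
  exact ⟨T, fun w hw => (hT hw).2, by rw [← hTs, hspan]⟩

/-- Take a homogeneous generating set of least cardinality. A relation having a coordinate with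
nonzero constant term would let the corresponding generator be discarded. -/
theorem exists_minimal_cover [Finite V] [Finite ι] {d : ι → ℕ}
    {N : Submodule (MvPolynomial V K) (ι → MvPolynomial V K)} (hN : IsHomogeneousSubmodule d N) :
    ∃ (k : ℕ) (e : Fin k → ℕ)
      (φ : (Fin k → MvPolynomial V K) →ₗ[MvPolynomial V K] (ι → MvPolynomial V K)),
      IsGraded e d φ ∧ LinearMap.range φ = N ∧ ∀ w ∈ LinearMap.ker φ, ∀ a,
        w a ∈ Ideal.span (Set.range (MvPolynomial.X : V → MvPolynomial V K)) := by
  classical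
  have hex : ∃ k, ∃ T : Finset (ι → MvPolynomial V K), T.card = k ∧
      (∀ w ∈ T, ∃ n, IsHomogeneousVector d n w) ∧
      Submodule.span (MvPolynomial V K) (T : Set (ι → MvPolynomial V K)) = N := by
    obtain ⟨T, hT⟩ := exists_finset_homogeneous_span hN
    exact ⟨_, T, rfl, hT⟩
  obtain ⟨T, hTk, hTh, hTN⟩ := Nat.find_spec hex
  have hmin := fun k => Nat.find_min hex (m := k)
  rw [← hTk] at hmin
  let g : Fin T.card → ι → MvPolynomial V K := fun i => T.equivFin.symm i
  have hgT : ∀ i, g i ∈ T := fun i => (T.equivFin.symm i).2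
  have hginj : Function.Injective g := Subtype.val_injective.comp T.equivFin.symm.injective
  have hrange : Set.range g = T := by
    ext w
    refine ⟨?_, fun hw => ⟨T.equivFin ⟨w, hw⟩, by simp [g]⟩⟩
    rintro ⟨i, rfl⟩
    exact hgT i
  choose e he using fun i => hTh (g i) (hgT i)
  have hφ : IsGraded e d (Fintype.linearCombination (MvPolynomial V K) g) :=
    isGraded_linearCombination he
  refine ⟨T.card, e, _, hφ, by rw [Fintype.range_linearCombination, hrange, hTN], ?_⟩
  intro w hw a
  apply mem_span_range_X_of_coeff_zero
  by_contra hc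
  -- The part of degree `e a` is still a relation, and its coordinate `a` is just the constant term,
  -- a unit.
  have hw' := hφ.isHomogeneousSubmodule_ker (e a) w hw
  have hwa : homogeneousPart e (e a) w a = MvPolynomial.C ((w a).coeff 0) := by
    ext m
    rw [coeff_homogeneousPart, MvPolynomial.coeff_C]
    by_cases hm : m = 0
    · simp [hm]
    · rw [if_neg, if_neg (Ne.symm hm)]
      have := (Finsupp.degree_eq_zero_iff m).not.mpr hm
      omega
  rw [LinearMap.mem_ker, Fintype.linearCombination_apply,
    ← Finset.add_sum_erase _ _ (Finset.mem_univ a), hwa] at hw'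
  have hga : g a ∈ Submodule.span (MvPolynomial V K)
      ((T.erase (g a) : Finset _) : Set (ι → MvPolynomial V K)) := by
    have h1 : (MvPolynomial.C ((w a).coeff 0) : MvPolynomial V K) • g a ∈
        Submodule.span (MvPolynomial V K)
          ((T.erase (g a) : Finset _) : Set (ι → MvPolynomial V K)) := by
      rw [eq_neg_of_add_eq_zero_left hw']
      refine Submodule.neg_mem _ (Submodule.sum_mem _ fun b hb =>
        Submodule.smul_mem _ _ (Submodule.subset_span ?_))
      rw [Finset.mem_coe, Finset.mem_erase]
      exact ⟨fun h => Finset.ne_of_mem_erase hb (hginj h), hgT b⟩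
    have h2 := Submodule.smul_mem _ (MvPolynomial.C ((w a).coeff 0)⁻¹ : MvPolynomial V K) h1
    rwa [smul_smul, ← MvPolynomial.C_mul, inv_mul_cancel₀ hc, MvPolynomial.C_1, one_smul] at h2
  refine hmin _ (Finset.card_erase_lt_of_mem (hgT a)) ⟨T.erase (g a), rfl,
    fun w hw => hTh w (Finset.mem_of_mem_erase hw), ?_⟩
  refine le_antisymm (hTN ▸ Submodule.span_mono (by simp)) ?_
  rw [← hTN, Submodule.span_le]
  intro t ht
  by_cases h : t = g a
  · exact h ▸ hga
  · exact Submodule.subset_span (Finset.mem_coe.mpr (Finset.mem_erase.mpr ⟨h, ht⟩))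

variable (V K) in
/-- A homogeneous submodule of a finite graded free module. -/
structure GradedSubmodule where
  rank : ℕ
  deg : Fin rank → ℕ
  carrier : Submodule (MvPolynomial V K) (Fin rank → MvPolynomial V K)
  isHomogeneous : IsHomogeneousSubmodule deg carrier

namespace GradedSubmodule

variable [Finite V] (N : GradedSubmodule V K)

/-- The rank of a minimal graded free cover of `N`. -/
noncomputable def coverRank : ℕ := (exists_minimal_cover N.isHomogeneous).choose

/-- The degrees of the basis of a minimal graded free cover of `N`. -/
noncomputable def coverDeg : Fin N.coverRank → ℕ :=
  (exists_minimal_cover N.isHomogeneous).choose_spec.choose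

/-- A minimal graded free cover of `N`. -/
noncomputable def cover : (Fin N.coverRank → MvPolynomial V K) →ₗ[MvPolynomial V K]
    (Fin N.rank → MvPolynomial V K) :=
  (exists_minimal_cover N.isHomogeneous).choose_spec.choose_spec.choose

theorem cover_spec : IsGraded N.coverDeg N.deg N.cover ∧ LinearMap.range N.cover = N.carrier ∧
    ∀ w ∈ LinearMap.ker N.cover, ∀ a,
      w a ∈ Ideal.span (Set.range (MvPolynomial.X : V → MvPolynomial V K)) :=
  (exists_minimal_cover N.isHomogeneous).choose_spec.choose_spec.choose_spec

/-- The first syzygy module of `N`. -/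
noncomputable def syzygy : GradedSubmodule V K where
  rank := N.coverRank
  deg := N.coverDeg
  carrier := LinearMap.ker N.cover
  isHomogeneous := N.cover_spec.1.isHomogeneousSubmodule_ker

/-- The iterated syzygy modules of `N`. -/
noncomputable def syzygies : ℕ → GradedSubmodule V K
  | 0 => N
  | i + 1 => (syzygies i).syzygy

end GradedSubmodule

theorem nonempty_minimalGradedFreeResolution [Finite V] {I : Ideal (MvPolynomial V K)}
    (hI : IsHomogeneousSubmodule (fun _ => 0) (idealSubmodule I)) :
    Nonempty (MinimalGradedFreeResolution I) := by
  obtain ⟨k, e, φ, hφ, hφI, hφm⟩ := exists_minimal_cover hI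
  let N : GradedSubmodule V K := ⟨k, e, LinearMap.ker φ, hφ.isHomogeneousSubmodule_ker⟩
  have hspec := fun i => (N.syzygies i).cover_spec
  refine ⟨{
    rank := fun i => (N.syzygies i).rank
    deg := fun i => (N.syzygies i).deg
    ε := LinearMap.proj () ∘ₗ φ
    d := fun i => (N.syzygies i).cover
    ε_homogeneous := fun a m hm => ?_
    d_homogeneous := fun i b => (hspec i).1 _ _ (isHomogeneousVector_single _ b)
    range_ε := ?_
    exact_zero := fun w => ?_
    exact_succ := fun i w => ?_
    minimal := fun i w a => ?_ }⟩
  · have := hφ _ _ (isHomogeneousVector_single e a) () m (MvPolynomial.mem_support_iff.mpr hm)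
    rw [Finsupp.degree_eq_weight_one] at this
    exact this
  · ext p
    constructor
    · rintro ⟨w, rfl⟩
      have : φ w ∈ idealSubmodule I := hφI ▸ ⟨w, rfl⟩
      exact this
    · intro hp
      obtain ⟨w, hw⟩ : (fun _ => p) ∈ LinearMap.range φ := hφI ▸ hp
      exact ⟨w, congr_fun hw ()⟩
  · have h : w ∈ LinearMap.range (N.syzygies 0).cover ↔ φ w = 0 := by
      rw [(hspec 0).2.1]
      rfl
    exact Iff.trans ⟨fun h => funext fun _ => h, fun h => congr_fun h ()⟩ h.symm
  · have h : w ∈ LinearMap.range (N.syzygies (i + 1)).cover ↔ (N.syzygies i).cover w = 0 := by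
      rw [(hspec (i + 1)).2.1]
      rfl
    exact h.symm
  · have h : (N.syzygies i).cover w ∈ (N.syzygies i).carrier := (hspec i).2.1 ▸ ⟨w, rfl⟩
    -- Minimality of the `i`-th differential comes from the cover one step earlier, which for `i =
    -- 0` is `φ`.
    cases i with
    | zero => exact hφm _ h a
    | succ i => exact (hspec i).2.2 _ h a

end Resolution

/-! ### Squarefree monomial ideals: splitting off variables, and basis exchange. -/

section SquarefreeMonomialIdeal

universe u v

variable {V : Type u} {K : Type v} [Field K]

theorem RegularityLE.mono {I : Ideal (MvPolynomial V K)} {r r' : ℤ} (h : RegularityLE I r)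
    (hr : r ≤ r') : RegularityLE I r' :=
  fun n => (h n).mono hr

theorem RegularityLE.sup {I J : Ideal (MvPolynomial V K)} {r : ℤ}
    (hI : IsHomogeneousSubmodule (fun _ => 0) (idealSubmodule I))
    (hJ : IsHomogeneousSubmodule (fun _ => 0) (idealSubmodule J))
    (hIr : RegularityLE I r) (hJr : RegularityLE J r) (hIJ : RegularityLE (I ⊓ J) (r + 1)) :
    RegularityLE (I ⊔ J) r := by
  intro n
  refine SyzygyBound.pred ?_
  convert SyzygyBound.sup hI hJ (hIr (n + 1)) (hJr (n + 1)) (hIJ n) using 1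
  ext w
  rw [Submodule.mem_sup]
  constructor
  · intro hw
    obtain ⟨a, ha, b, hb, hab⟩ := Submodule.mem_sup.mp hw
    exact ⟨fun _ => a, ha, fun _ => b, hb, funext fun _ => hab⟩
  · rintro ⟨a, ha, b, hb, rfl⟩
    exact Submodule.add_mem_sup (S := I) (T := J) ha hb

/-- Multiplication by a variable is injective, and preserves degrees once the source is shifted by
one. -/
theorem RegularityLE.span_X_mul {I : Ideal (MvPolynomial V K)} {r : ℤ} (hI : RegularityLE I r)
    (x : V) : RegularityLE (Ideal.span {MvPolynomial.X x} * I) (r + 1) := by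
  intro n
  convert (hI n).shift.map (e := fun _ : Unit => 0)
    (φ := LinearMap.lsmul (MvPolynomial V K) (Unit → MvPolynomial V K) (MvPolynomial.X x))
    ?_ ?_ using 1
  · ext w
    refine Ideal.mem_span_singleton_mul.trans ?_
    constructor
    · rintro ⟨z, hz, hzw⟩
      exact ⟨fun _ => z, hz, funext fun _ => hzw⟩
    · rintro ⟨z, hz, rfl⟩
      exact ⟨_, hz, rfl⟩
  · intro m w hw a p hp
    rw [LinearMap.lsmul_apply, Pi.smul_apply, smul_eq_mul, MvPolynomial.support_X_mul,
      Finset.mem_map] at hp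
    obtain ⟨q, hq, rfl⟩ := hp
    rw [addLeftEmbedding_apply, map_add, Finsupp.degree_single, ← hw a q hq]
    ring
  · rw [Submodule.disjoint_def]
    intro w _ hw
    rw [LinearMap.mem_ker, LinearMap.lsmul_apply] at hw
    exact (smul_eq_zero.mp hw).resolve_left (MvPolynomial.X_ne_zero x)

/-- The exponent vector of the squarefree monomial with support `A`. -/
noncomputable def exponentVector (A : Finset V) : V →₀ ℕ :=
  Finsupp.indicator A fun _ _ => 1

theorem exponentVector_le_iff {A : Finset V} {m : V →₀ ℕ} :
    exponentVector A ≤ m ↔ A ⊆ m.support := by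
  classical
  constructor
  · intro h v hv
    have := h v
    rw [exponentVector, Finsupp.indicator_apply, dif_pos hv] at this
    rw [Finsupp.mem_support_iff]
    omega
  · intro h v
    rw [exponentVector, Finsupp.indicator_apply]
    split_ifs with hv
    · have := Finsupp.mem_support_iff.mp (h hv)
      omega
    · exact Nat.zero_le _

theorem exponentVector_le_one (A : Finset V) (v : V) : exponentVector A v ≤ 1 := by
  classical
  rw [exponentVector, Finsupp.indicator_apply]
  split_ifs <;> simp

theorem support_exponentVector (A : Finset V) : (exponentVector A).support = A := by
  classical
  ext v
  rw [Finsupp.mem_support_iff, exponentVector, Finsupp.indicator_apply]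
  split_ifs with h <;> simp [h]

variable (K) in
/-- The ideal generated by the squarefree monomials with supports in the family `𝓕`. -/
noncomputable def squarefreeIdeal (𝓕 : Set (Finset V)) : Ideal (MvPolynomial V K) :=
  Ideal.span ((fun m => MvPolynomial.monomial m 1) '' (exponentVector '' 𝓕))

theorem mem_squarefreeIdeal {𝓕 : Set (Finset V)} {p : MvPolynomial V K} :
    p ∈ squarefreeIdeal K 𝓕 ↔ ∀ m ∈ p.support, ∃ A ∈ 𝓕, A ⊆ m.support := by
  rw [squarefreeIdeal, MvPolynomial.mem_ideal_span_monomial_image]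
  simp_rw [Set.exists_mem_image, exponentVector_le_iff]

theorem squarefreeIdeal_mono {𝓕 𝓖 : Set (Finset V)} (h : ∀ A ∈ 𝓕, ∃ B ∈ 𝓖, B ⊆ A) :
    squarefreeIdeal K 𝓕 ≤ squarefreeIdeal K 𝓖 := by
  intro p hp
  rw [mem_squarefreeIdeal] at hp ⊢
  intro m hm
  obtain ⟨A, hA, hAm⟩ := hp m hm
  obtain ⟨B, hB, hBA⟩ := h A hA
  exact ⟨B, hB, hBA.trans hAm⟩

theorem isHomogeneousSubmodule_squarefreeIdeal (𝓕 : Set (Finset V)) :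
    IsHomogeneousSubmodule (fun _ => 0) (idealSubmodule (squarefreeIdeal K 𝓕)) := by
  intro n w hw
  have hw' := mem_squarefreeIdeal.mp hw
  refine mem_squarefreeIdeal.mpr fun m hm => hw' m ?_
  have hm' := MvPolynomial.mem_support_iff.mp hm
  rw [LinearMap.proj_apply, coeff_homogeneousPart] at hm'
  rw [MvPolynomial.mem_support_iff]
  exact fun h => hm' (ite_eq_right_iff.mpr fun _ => h)

theorem regularityLE_bot (r : ℤ) : RegularityLE (⊥ : Ideal (MvPolynomial V K)) r := by
  intro n
  convert syzygyBound_bot (V := V) (K := K) n (fun _ : Unit => 0) r using 1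
  ext w
  exact ⟨fun h => funext fun _ => h, fun h => congr_fun h ()⟩

theorem regularityLE_top : RegularityLE (⊤ : Ideal (MvPolynomial V K)) 0 := by
  intro n
  exact syzygyBound_top n (d := fun _ : Unit => 0) fun _ => le_rfl

variable [DecidableEq V]

theorem squarefreeIdeal_eq_sup (𝓕 : Set (Finset V)) (x : V) :
    squarefreeIdeal K 𝓕 = squarefreeIdeal K {A ∈ 𝓕 | x ∉ A} ⊔
      Ideal.span {MvPolynomial.X x} * squarefreeIdeal K ((fun A => A.erase x) '' 𝓕) := by
  apply le_antisymm
  · conv_lhs => rw [squarefreeIdeal]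
    rw [Ideal.span_le]
    rintro _ ⟨_, ⟨A, hA, rfl⟩, rfl⟩
    by_cases hx : x ∈ A
    · refine Ideal.mem_sup_right (Ideal.mem_span_singleton_mul.mpr
        ⟨MvPolynomial.monomial (exponentVector (A.erase x)) 1, ?_, ?_⟩)
      · exact Ideal.subset_span ⟨_, ⟨_, ⟨A, hA, rfl⟩, rfl⟩, rfl⟩
      · rw [MvPolynomial.X, MvPolynomial.monomial_mul, one_mul]
        congr 2
        ext v
        rw [Finsupp.add_apply, exponentVector, exponentVector, Finsupp.indicator_apply,
          Finsupp.indicator_apply, Finsupp.single_apply]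
        by_cases hv : x = v
        · subst hv
          simp [hx]
        · simp [hv, Ne.symm hv]
    · exact Ideal.mem_sup_left (Ideal.subset_span ⟨_, ⟨A, ⟨hA, hx⟩, rfl⟩, rfl⟩)
  · refine sup_le (squarefreeIdeal_mono fun A hA => ⟨A, hA.1, subset_rfl⟩) fun p hp => ?_
    obtain ⟨z, hz, rfl⟩ := Ideal.mem_span_singleton_mul.mp hp
    rw [mem_squarefreeIdeal] at hz ⊢
    intro m hm
    rw [MvPolynomial.support_X_mul, Finset.mem_map] at hm
    obtain ⟨q, hq, rfl⟩ := hm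
    obtain ⟨_, ⟨A, hA, rfl⟩, hAq⟩ := hz q hq
    refine ⟨A, hA, fun v hv => ?_⟩
    rw [addLeftEmbedding_apply, Finsupp.mem_support_iff, Finsupp.add_apply]
    by_cases hvx : v = x
    · subst hvx
      simp
    · have := Finsupp.mem_support_iff.mp (hAq (Finset.mem_erase.mpr ⟨hvx, hv⟩))
      omega

/-- The generators on the left avoid `x`, so one dividing a monomial of `x z` already divides the
monomial of `z`. -/
theorem squarefreeIdeal_inf_eq (𝓕 : Set (Finset V)) (x : V) :
    squarefreeIdeal K {A ∈ 𝓕 | x ∉ A} ⊓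
      Ideal.span {MvPolynomial.X x} * squarefreeIdeal K ((fun A => A.erase x) '' 𝓕) =
    Ideal.span {MvPolynomial.X x} * squarefreeIdeal K {A ∈ 𝓕 | x ∉ A} := by
  apply le_antisymm
  · rintro p ⟨hp, hp'⟩
    obtain ⟨z, -, rfl⟩ := Ideal.mem_span_singleton_mul.mp hp'
    refine Ideal.mem_span_singleton_mul.mpr ⟨z, ?_, rfl⟩
    rw [SetLike.mem_coe, mem_squarefreeIdeal] at hp
    rw [mem_squarefreeIdeal]
    intro m hm
    obtain ⟨A, hA, hAm⟩ := hp (Finsupp.single x 1 + m) (by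
      rw [MvPolynomial.support_X_mul]
      exact Finset.mem_map_of_mem _ hm)
    refine ⟨A, hA, fun v hv => ?_⟩
    have := Finsupp.mem_support_iff.mp (hAm hv)
    rw [Finsupp.add_apply, Finsupp.single_apply, if_neg (by rintro rfl; exact hA.2 hv),
      zero_add] at this
    exact Finsupp.mem_support_iff.mpr this
  · refine le_inf Ideal.mul_le_right (Ideal.mul_mono_right (squarefreeIdeal_mono fun A hA => ?_))
    exact ⟨A, ⟨A, hA.1, Finset.erase_eq_of_notMem hA.2⟩, subset_rfl⟩

theorem isHomogeneousSubmodule_span_X_mul (𝓕 : Set (Finset V)) (x : V) :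
    IsHomogeneousSubmodule (fun _ => 0) (idealSubmodule
      (Ideal.span {MvPolynomial.X x} * squarefreeIdeal K ((fun A => A.erase x) '' 𝓕))) := by
  have h : Ideal.span {MvPolynomial.X x} * squarefreeIdeal K ((fun A => A.erase x) '' 𝓕) =
      squarefreeIdeal K ((fun A => insert x A) '' 𝓕) := by
    rw [squarefreeIdeal_eq_sup ((fun A => insert x A) '' 𝓕) x]
    rw [sup_eq_right.mpr]
    · congr 2
      ext A
      simp [Set.mem_image, Finset.erase_insert_eq_erase]
    -- Every member of the new family contains `x`, so the summand avoiding `x` is zero.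
    · intro p hp
      have : p = 0 := by
        rw [← MvPolynomial.support_eq_empty, Finset.eq_empty_iff_forall_notMem]
        intro m hm
        obtain ⟨A, ⟨⟨B, -, rfl⟩, hA⟩, -⟩ := mem_squarefreeIdeal.mp hp m hm
        exact hA (Finset.mem_insert_self x B)
      exact this ▸ Ideal.zero_mem _
  rw [h]
  exact isHomogeneousSubmodule_squarefreeIdeal _

theorem regularityLE_squarefreeIdeal_of_split {𝓕 : Set (Finset V)} (x : V) {r : ℤ}
    (h₀ : RegularityLE (squarefreeIdeal K {A ∈ 𝓕 | x ∉ A}) r)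
    (h₁ : RegularityLE (squarefreeIdeal K ((fun A => A.erase x) '' 𝓕)) (r - 1)) :
    RegularityLE (squarefreeIdeal K 𝓕) r := by
  rw [squarefreeIdeal_eq_sup 𝓕 x]
  refine RegularityLE.sup (isHomogeneousSubmodule_squarefreeIdeal _)
    (isHomogeneousSubmodule_span_X_mul 𝓕 x) h₀ ?_ ?_
  · simpa using h₁.span_X_mul x
  · rw [squarefreeIdeal_inf_eq]
    exact h₀.span_X_mul x

/-- Iterated splitting: `σ` collects the variables of `P` that were set to `1`, each lowering the
allowed bound by one; the other variables of `P` were avoided. -/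
theorem regularityLE_squarefreeIdeal_of_slices (P : Finset V) {𝓕 : Set (Finset V)} {r : ℤ}
    (h : ∀ σ ⊆ P, RegularityLE
      (squarefreeIdeal K ((fun A => A \ P) '' {A ∈ 𝓕 | A ∩ P ⊆ σ})) (r - σ.card)) :
    RegularityLE (squarefreeIdeal K 𝓕) r := by
  induction P using Finset.induction_on generalizing 𝓕 r with
  | empty =>
    have := h ∅ subset_rfl
    simpa using this
  | insert x P hx ih =>
    refine regularityLE_squarefreeIdeal_of_split x (ih fun σ hσ => ?_) (ih fun σ hσ => ?_)
    · convert h σ (hσ.trans (Finset.subset_insert x P)) using 2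
      have hxσ : x ∉ σ := fun hxσ => hx (hσ hxσ)
      ext B
      constructor
      · rintro ⟨A, ⟨⟨hA, hxA⟩, hAσ⟩, rfl⟩
        refine ⟨A, ⟨hA, ?_⟩, ?_⟩
        · rwa [Finset.inter_insert_of_notMem hxA]
        · exact Finset.sdiff_insert_of_notMem hxA P
      · rintro ⟨A, ⟨hA, hAσ⟩, rfl⟩
        have hxA : x ∉ A := fun hxA =>
          hxσ (hAσ (Finset.mem_inter.mpr ⟨hxA, Finset.mem_insert_self x P⟩))
        refine ⟨A, ⟨⟨hA, hxA⟩, ?_⟩, ?_⟩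
        · rwa [Finset.inter_insert_of_notMem hxA] at hAσ
        · exact (Finset.sdiff_insert_of_notMem hxA P).symm
    · have hxσ : x ∉ σ := fun hxσ => hx (hσ hxσ)
      have hr : r - 1 - σ.card = r - (insert x σ).card := by
        rw [Finset.card_insert_of_notMem hxσ]
        push_cast
        ring
      rw [hr]
      convert h (insert x σ) (Finset.insert_subset_insert x hσ) using 2
      · ext B
        constructor
        · rintro ⟨_, ⟨⟨A, hA, rfl⟩, hAσ⟩, rfl⟩
          refine ⟨A, ⟨hA, ?_⟩, ?_⟩
          · grind
          · grind
        · rintro ⟨A, ⟨hA, hAσ⟩, rfl⟩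
          refine ⟨A.erase x, ⟨⟨A, hA, rfl⟩, ?_⟩, ?_⟩
          · grind
          · grind

/-- Matroidal ideals have linear resolutions, by deletion and contraction. The exchange axiom
prescribes the incoming element, as the contraction step needs. -/
theorem regularityLE_squarefreeIdeal_of_exchange (Y : Finset V) {𝓑 : Set (Finset V)} {s : ℕ}
    (hY : ∀ B ∈ 𝓑, B ⊆ Y) (hs : ∀ B ∈ 𝓑, B.card = s)
    (hex : ∀ B ∈ 𝓑, ∀ B' ∈ 𝓑, ∀ y ∈ B' \ B, ∃ z ∈ B \ B', insert y (B.erase z) ∈ 𝓑) :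
    RegularityLE (squarefreeIdeal K 𝓑) s := by
  induction Y using Finset.induction_on generalizing 𝓑 s with
  | empty =>
    by_cases h : ∅ ∈ 𝓑
    · have h1 : squarefreeIdeal K 𝓑 = ⊤ := by
        rw [Ideal.eq_top_iff_one, mem_squarefreeIdeal]
        exact fun m _ => ⟨∅, h, Finset.empty_subset _⟩
      rw [h1, ← hs ∅ h]
      exact regularityLE_top
    · have h1 : 𝓑 = ∅ := Set.eq_empty_of_forall_notMem fun B hB =>
        h (Finset.subset_empty.mp (hY B hB) ▸ hB)
      have h2 : squarefreeIdeal K 𝓑 = ⊥ := by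
        rw [h1, squarefreeIdeal, Set.image_empty, Set.image_empty, Ideal.span_empty]
      rw [h2]
      exact regularityLE_bot _
  | insert y Y hy ih =>
    have hdel : RegularityLE (squarefreeIdeal K {B ∈ 𝓑 | y ∉ B}) s := by
      refine ih (fun B hB => ?_) (fun B hB => hs B hB.1) fun B hB B' hB' x hx => ?_
      · exact (Finset.subset_insert_iff_of_notMem hB.2).mp (hY B hB.1)
      · obtain ⟨z, hz, h⟩ := hex B hB.1 B' hB'.1 x hx
        refine ⟨z, hz, h, ?_⟩
        have h1 := hB.2
        have h2 := hB'.2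
        grind
    by_cases hc : ∃ B₀ ∈ 𝓑, y ∈ B₀
    · obtain ⟨B₀, hB₀, hyB₀⟩ := hc
      refine regularityLE_squarefreeIdeal_of_split y hdel ?_
      -- Sets avoiding `y` become redundant: exchanging `y` into such a `B` and erasing it leaves
      -- `B.erase z ⊆ B`. The remaining generators all have `s - 1` elements.
      have hlink : squarefreeIdeal K ((fun B => B.erase y) '' 𝓑) =
          squarefreeIdeal K ((fun B => B.erase y) '' {B ∈ 𝓑 | y ∈ B}) := by
        apply le_antisymm
        · refine squarefreeIdeal_mono ?_
          rintro _ ⟨B, hB, rfl⟩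
          by_cases hyB : y ∈ B
          · exact ⟨_, ⟨B, ⟨hB, hyB⟩, rfl⟩, subset_rfl⟩
          · obtain ⟨z, hz, h⟩ := hex B hB B₀ hB₀ y (Finset.mem_sdiff.mpr ⟨hyB₀, hyB⟩)
            refine ⟨_, ⟨_, ⟨h, Finset.mem_insert_self _ _⟩, rfl⟩, ?_⟩
            grind
        · exact squarefreeIdeal_mono fun A ⟨B, hB, hBA⟩ => ⟨A, ⟨B, hB.1, hBA⟩, subset_rfl⟩
      rw [hlink]
      have hpos : 1 ≤ s := hs B₀ hB₀ ▸ Finset.card_pos.mpr ⟨y, hyB₀⟩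
      rw [← Nat.cast_one, ← Nat.cast_sub hpos]
      refine ih ?_ ?_ ?_
      · rintro _ ⟨B, hB, rfl⟩
        exact Finset.subset_insert_iff.mp (hY B hB.1)
      · rintro _ ⟨B, hB, rfl⟩
        rw [Finset.card_erase_of_mem hB.2, hs B hB.1]
      · rintro _ ⟨B, ⟨hB, hyB⟩, rfl⟩ _ ⟨B', ⟨hB', hyB'⟩, rfl⟩ x hx
        obtain ⟨z, hz, h⟩ := hex B hB B' hB' x (by grind)
        refine ⟨z, by grind, _, ⟨h, by grind⟩, ?_⟩
        grind
    · push Not at hc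
      rwa [Set.sep_eq_self_iff_mem_true.mpr hc] at hdel

end SquarefreeMonomialIdeal

/-! ### Matchings, the transversal exchange property and the edge ideal. -/

section Matching

universe u v

variable {V : Type u} {G : SimpleGraph V}

/-- The map `f` matches `B` into `σ` along edges of `G`. -/
def IsMatchedInto (G : SimpleGraph V) (σ B : Finset V) (f : V → V) : Prop :=
  Set.InjOn f B ∧ ∀ b ∈ B, f b ∈ σ ∧ G.Adj b (f b)

theorem IsMatchedInto.subset {σ B B' : Finset V} {f : V → V} (h : IsMatchedInto G σ B f)
    (hB : B' ⊆ B) : IsMatchedInto G σ B' f :=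
  ⟨h.1.mono hB, fun b hb => h.2 b (hB hb)⟩

variable [DecidableEq V]

theorem IsMatchedInto.insert_update {σ B : Finset V} {f : V → V} (h : IsMatchedInto G σ B f) {y x : V}
    (hx : x ∈ σ) (hyx : G.Adj y x) (hfx : ∀ b ∈ B, f b ≠ x) :
    IsMatchedInto G σ (insert y B) (Function.update f y x) := by
  constructor
  · intro a ha b hb hab
    rw [Finset.mem_coe, Finset.mem_insert] at ha hb
    have := @h.1
    simp only [Set.InjOn, Finset.mem_coe] at this
    simp only [Function.update_apply] at hab
    split_ifs at hab <;> grind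
  · intro b hb
    have := h.2
    simp only [Function.update_apply]
    split_ifs <;> grind

/-- An alternating path argument. Send `y` to `f' y`. If that vertex is free, drop any element of `B
\ B'`; if its owner `y₁` lies outside `B'`, drop `y₁`; otherwise displace `y₁` and repeat with `y₁`
as the element to be inserted. -/
theorem IsMatchedInto.exists_exchange {σ B B' : Finset V} {f f' : V → V}
    (h : IsMatchedInto G σ B f) (h' : IsMatchedInto G σ B' f') (hcard : B.card = B'.card)
    {y : V} (hy : y ∈ B' \ B) :
    ∃ z ∈ B \ B', ∃ g, IsMatchedInto G σ (insert y (B.erase z)) g := by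
  obtain ⟨hyB', hyB⟩ := Finset.mem_sdiff.mp hy
  -- Displacement increases the agreement of `f` with `f'`: `y` now agrees, while `y₁` did not, as
  -- `f y₁ = f' y` and `f'` is injective on `B'`.
  induction hn : (B'.card - (B.filter fun b => b ∈ B' ∧ f b = f' b).card)
    using Nat.strong_induction_on generalizing B f y with
  | _ n ih =>
    by_cases hcov : ∃ y₁ ∈ B, f y₁ = f' y
    · obtain ⟨y₁, hy₁, hfy₁⟩ := hcov
      have hins : IsMatchedInto G σ (insert y (B.erase y₁)) (Function.update f y (f' y)) := by
        refine (h.subset (Finset.erase_subset y₁ B)).insert_update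
          (h'.2 y hyB').1 (h'.2 y hyB').2 fun b hb hfb => ?_
        exact (Finset.ne_of_mem_erase hb)
          (h.1 (Finset.mem_of_mem_erase hb) hy₁ (hfb.trans hfy₁.symm))
      by_cases hy₁B' : y₁ ∈ B'
      · have hne : y₁ ≠ y := fun he => hyB (he ▸ hy₁)
        have hcard₂ : (insert y (B.erase y₁)).card = B.card := by
          rw [Finset.card_insert_of_notMem fun hmem => hyB (Finset.mem_of_mem_erase hmem),
            Finset.card_erase_add_one hy₁]
        have hagree : (B.filter fun b => b ∈ B' ∧ f b = f' b).card <
            ((insert y (B.erase y₁)).filter fun b => b ∈ B' ∧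
              Function.update f y (f' y) b = f' b).card := by
          refine Finset.card_lt_card
            (Finset.ssubset_iff_subset_ne.mpr ⟨fun b hb => ?_, fun he => ?_⟩)
          · obtain ⟨hbB, hbB', hfb⟩ := Finset.mem_filter.mp hb
            have hby : b ≠ y := fun he => hyB (he ▸ hbB)
            have hby₁ : b ≠ y₁ := by
              rintro rfl
              exact hby (h'.1 hbB' hyB' (hfb.symm.trans hfy₁))
            refine Finset.mem_filter.mpr ⟨Finset.mem_insert_of_mem
              (Finset.mem_erase.mpr ⟨hby₁, hbB⟩), hbB', ?_⟩
            rw [Function.update_of_ne hby, hfb]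
          · have : y ∈ B.filter fun b => b ∈ B' ∧ f b = f' b := by
              rw [he]
              exact Finset.mem_filter.mpr ⟨Finset.mem_insert_self _ _, hyB',
                Function.update_self _ _ _⟩
            exact hyB (Finset.mem_filter.mp this).1
        have hle : ((insert y (B.erase y₁)).filter fun b => b ∈ B' ∧
              Function.update f y (f' y) b = f' b).card ≤ B'.card :=
          Finset.card_le_card fun b hb => (Finset.mem_filter.mp hb).2.1
        have hy₁' : y₁ ∉ insert y (B.erase y₁) := by
          simp [hne]
        obtain ⟨z, hz, g, hg⟩ := ih _ (by omega) hins (hcard₂.trans hcard)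
          (Finset.mem_sdiff.mpr ⟨hy₁B', hy₁'⟩) hy₁B' hy₁' rfl
        refine ⟨z, by grind, g, ?_⟩
        have hset : insert y₁ ((insert y (B.erase y₁)).erase z) = insert y (B.erase z) := by
          grind
        rwa [hset] at hg
      · exact ⟨y₁, Finset.mem_sdiff.mpr ⟨hy₁, hy₁B'⟩, _, hins⟩
    · push Not at hcov
      obtain ⟨z, hz⟩ : (B \ B').Nonempty := by
        rw [Finset.sdiff_nonempty]
        intro hsub
        exact hyB (Finset.eq_of_subset_of_card_le hsub hcard.ge ▸ hyB')
      refine ⟨z, hz, _, (h.insert_update (h'.2 y hyB').1 (h'.2 y hyB').2 hcov).subset ?_⟩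
      exact Finset.insert_subset_insert y (Finset.erase_subset z B)

variable {K : Type v} [Field K]

theorem regularityLE_matchedInto (G : SimpleGraph V) (σ Y : Finset V) (s : ℕ) :
    RegularityLE (squarefreeIdeal K
      {B | B ⊆ Y ∧ B.card = s ∧ ∃ f, IsMatchedInto G σ B f}) s := by
  refine regularityLE_squarefreeIdeal_of_exchange Y (fun B hB => hB.1) (fun B hB => hB.2.1) ?_
  rintro B ⟨hBY, hBs, f, hf⟩ B' ⟨hBY', hBs', f', hf'⟩ y hy
  obtain ⟨z, hz, g, hg⟩ := hf.exists_exchange hf' (hBs.trans hBs'.symm) hy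
  obtain ⟨hyB', hyB⟩ := Finset.mem_sdiff.mp hy
  refine ⟨z, hz, ?_, ?_, g, hg⟩
  · exact Finset.insert_subset (hBY' hyB') ((Finset.erase_subset z B).trans hBY)
  · rw [Finset.card_insert_of_notMem fun hmem => hyB (Finset.mem_of_mem_erase hmem),
      Finset.card_erase_add_one (Finset.mem_sdiff.mp hz).1, hBs]

/-- The vertex sets of the matchings of size `s` between `X` and `Y`. -/
def matchedVertexSets (G : SimpleGraph V) (X Y : Finset V) (s : ℕ) : Set (Finset V) :=
  {A | ∃ B f, B ⊆ Y ∧ B.card = s ∧ IsMatchedInto G X B f ∧ A = B ∪ B.image f}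

/-- Slicing along `X` turns the condition that the `X`-endpoints lie in `σ` into matchability of the
`Y`-endpoints into `σ`. -/
theorem regularityLE_matchedVertexSets {X Y : Finset V} (hXY : Disjoint X Y) (s : ℕ) :
    RegularityLE (squarefreeIdeal K (matchedVertexSets G X Y s)) (X.card + s) := by
  refine regularityLE_squarefreeIdeal_of_slices X fun σ hσ => ?_
  have hle : (s : ℤ) ≤ X.card + s - σ.card := by
    have := Finset.card_le_card hσ
    omega
  convert (regularityLE_matchedInto (K := K) G σ Y s).mono hle using 2
  have hsub : ∀ {B : Finset V} {f : V → V}, B ⊆ Y → B.image f ⊆ X →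
      (B ∪ B.image f) \ X = B ∧ (B ∪ B.image f) ∩ X = B.image f := by
    intro B f hB hf
    have hBX : Disjoint B X := (hXY.mono_right hB).symm
    constructor
    · rw [Finset.union_sdiff_distrib, Finset.sdiff_eq_self_of_disjoint hBX,
        Finset.sdiff_eq_empty_iff_subset.mpr hf, Finset.union_empty]
    · rw [Finset.union_inter_distrib_right, Finset.disjoint_iff_inter_eq_empty.mp hBX,
        Finset.inter_eq_left.mpr hf, Finset.empty_union]
  have himage : ∀ {τ B : Finset V} {f : V → V}, IsMatchedInto G τ B f → B.image f ⊆ τ :=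
    fun h => Finset.image_subset_iff.mpr fun b hb => (h.2 b hb).1
  ext B
  constructor
  · rintro ⟨_, ⟨⟨B, f, hB, hs, hf, rfl⟩, hσ'⟩, rfl⟩
    obtain ⟨h₁, h₂⟩ := hsub hB (himage hf)
    rw [h₂] at hσ'
    change (B ∪ B.image f) \ X ∈ _
    rw [h₁]
    refine ⟨hB, hs, f, ?_⟩
    exact ⟨hf.1, fun b hb => ⟨hσ' (Finset.mem_image_of_mem f hb), (hf.2 b hb).2⟩⟩
  · rintro ⟨hB, hs, f, hf⟩
    obtain ⟨h₁, h₂⟩ := hsub hB ((himage hf).trans hσ)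
    refine ⟨B ∪ B.image f, ⟨⟨B, f, hB, hs, ?_, rfl⟩, by rw [h₂]; exact himage hf⟩, h₁⟩
    exact ⟨hf.1, fun b hb => ⟨hσ (hf.2 b hb).1, (hf.2 b hb).2⟩⟩

/-! ### The squarefree power as the ideal of matched vertex sets. -/

theorem monomial_exponentVector (A : Finset V) :
    MvPolynomial.monomial (exponentVector A) (1 : K) = ∏ v ∈ A, MvPolynomial.X v := by
  rw [MvPolynomial.monomial_eq, MvPolynomial.C_1, one_mul, Finsupp.prod, support_exponentVector]
  refine Finset.prod_congr rfl fun v hv => ?_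
  rw [exponentVector, Finsupp.indicator_apply, dif_pos hv, pow_one]

theorem exists_adj_of_mem_support {p : MvPolynomial V K} (hp : p ∈ edgeIdeal K G) {m : V →₀ ℕ}
    (hm : m ∈ p.support) : ∃ u v, G.Adj u v ∧ u ∈ m.support ∧ v ∈ m.support := by
  have hle : edgeIdeal K G ≤ squarefreeIdeal K {A | ∃ u v, G.Adj u v ∧ A = {u, v}} := by
    refine Ideal.span_le.mpr ?_
    rintro _ ⟨u, v, huv, rfl⟩
    refine Ideal.subset_span ⟨_, ⟨{u, v}, ⟨u, v, huv, rfl⟩, rfl⟩, ?_⟩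
    change MvPolynomial.monomial _ 1 = _
    rw [monomial_exponentVector, Finset.prod_pair huv.ne]
  obtain ⟨_, ⟨u, v, huv, rfl⟩, hA⟩ := mem_squarefreeIdeal.mp (hle hp) m hm
  exact ⟨u, v, huv, hA (by simp), hA (by simp)⟩

/-- Peel off one factor at a time. Since the exponents of `m₁ + m₂` are at most one, the two
supports are disjoint, so an edge found in `m₂` extends a matching found in `m₁`. -/
theorem exists_matchedVertexSet_of_mem_pow {X Y : Finset V}
    (hG : G.IsBipartiteWith (X : Set V) (Y : Set V)) {s : ℕ} {p : MvPolynomial V K}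
    (hp : p ∈ edgeIdeal K G ^ s) {m : V →₀ ℕ} (hm : m ∈ p.support) (hm1 : ∀ v, m v ≤ 1) :
    ∃ A ∈ matchedVertexSets G X Y s, A ⊆ m.support := by
  induction s generalizing p m with
  | zero =>
    exact ⟨∅, ⟨∅, id, by simp, rfl, ⟨by simp, by simp⟩, by simp⟩, Finset.empty_subset _⟩
  | succ s ih =>
    rw [pow_succ] at hp
    revert hm
    refine Submodule.mul_induction_on hp (fun a ha b hb hm => ?_) fun a b ha hb hm => ?_
    · obtain ⟨m₁, hm₁, m₂, hm₂, rfl⟩ := Finset.mem_add.mp (MvPolynomial.support_mul a b hm)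
      obtain ⟨_, ⟨B, f, hBY, hBs, hf, rfl⟩, hA⟩ := ih ha hm₁ fun v =>
        (Nat.le_add_right _ _).trans (hm1 v)
      have key : ∃ u v, G.Adj u v ∧ u ∈ Y ∧ v ∈ X ∧ u ∈ m₂.support ∧ v ∈ m₂.support := by
        obtain ⟨u, v, huv, hu, hv⟩ := exists_adj_of_mem_support hb hm₂
        rcases hG.mem_of_adj huv with ⟨h₁, h₂⟩ | ⟨h₁, h₂⟩
        · exact ⟨v, u, huv.symm, h₂, h₁, hv, hu⟩
        · exact ⟨u, v, huv, h₁, h₂, hu, hv⟩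
      obtain ⟨u, v, huv, huY, hvX, hu, hv⟩ := key
      have hdisj : ∀ {w}, w ∈ m₂.support → w ∉ B ∪ B.image f := by
        intro w hw hwB
        have h₁ := Finsupp.mem_support_iff.mp (hA hwB)
        have h₂ := Finsupp.mem_support_iff.mp hw
        have h₃ := hm1 w
        rw [Finsupp.add_apply] at h₃
        omega
      have huB : u ∉ B := fun h => hdisj hu (Finset.mem_union_left _ h)
      have hvB : ∀ b ∈ B, f b ≠ v := fun b hb he =>
        hdisj hv (Finset.mem_union_right _ (Finset.mem_image.mpr ⟨b, hb, he⟩))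
      refine ⟨_, ⟨insert u B, Function.update f u v, Finset.insert_subset huY hBY,
        by rw [Finset.card_insert_of_notMem huB, hBs], hf.insert_update hvX huv hvB, rfl⟩, ?_⟩
      have hsup : ∀ {w}, w ∈ m₁.support ∨ w ∈ m₂.support → w ∈ (m₁ + m₂).support := by
        intro w hw
        rw [Finsupp.mem_support_iff, Finsupp.mem_support_iff] at hw
        rw [Finsupp.mem_support_iff, Finsupp.add_apply]
        omega
      intro w hw
      rcases Finset.mem_union.mp hw with hw | hw
      · rcases Finset.mem_insert.mp hw with rfl | hw
        · exact hsup (Or.inr hu)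
        · exact hsup (Or.inl (hA (Finset.mem_union_left _ hw)))
      · obtain ⟨b, hb, rfl⟩ := Finset.mem_image.mp hw
        rcases Finset.mem_insert.mp hb with rfl | hb
        · rw [Function.update_self]
          exact hsup (Or.inr hv)
        · rw [Function.update_of_ne (ne_of_mem_of_not_mem hb huB)]
          exact hsup (Or.inl (hA (Finset.mem_union_right _ (Finset.mem_image_of_mem f hb))))
    · rcases Finset.mem_union.mp (MvPolynomial.support_add hm) with h | h
      exacts [ha h, hb h]

theorem monomial_mem_pow_edgeIdeal {X Y A : Finset V} (hXY : Disjoint X Y) {s : ℕ}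
    (hA : A ∈ matchedVertexSets G X Y s) :
    MvPolynomial.monomial (exponentVector A) (1 : K) ∈ edgeIdeal K G ^ s := by
  obtain ⟨B, f, hBY, rfl, hf, rfl⟩ := hA
  have hdisj : Disjoint B (B.image f) := by
    refine (hXY.mono ?_ hBY).symm
    exact Finset.image_subset_iff.mpr fun b hb => (hf.2 b hb).1
  rw [monomial_exponentVector, Finset.prod_union hdisj, Finset.prod_image hf.1,
    ← Finset.prod_mul_distrib, ← Finset.prod_const]
  exact Ideal.prod_mem_prod fun b hb => Ideal.subset_span ⟨b, f b, (hf.2 b hb).2, rfl⟩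

theorem squarefreePower_edgeIdeal_eq {X Y : Finset V}
    (hG : G.IsBipartiteWith (X : Set V) (Y : Set V)) (s : ℕ) :
    squarefreePower (edgeIdeal K G) s = squarefreeIdeal K (matchedVertexSets G X Y s) := by
  apply le_antisymm
  · refine Ideal.span_le.mpr ?_
    rintro _ ⟨m, hm1, rfl, hm⟩
    refine mem_squarefreeIdeal.mpr fun q hq => ?_
    have hqm : q = m := by
      simpa using MvPolynomial.support_monomial_subset hq
    subst hqm
    exact exists_matchedVertexSet_of_mem_pow hG hm hq hm1
  · refine Ideal.span_le.mpr ?_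
    rintro _ ⟨_, ⟨A, hA, rfl⟩, rfl⟩
    exact Ideal.subset_span ⟨_, exponentVector_le_one A, rfl,
      monomial_mem_pow_edgeIdeal (Finset.disjoint_coe.mp hG.disjoint) hA⟩

/-- Each edge of a maximum matching is determined by its endpoint in `Y`; keep `s` of these
endpoints and their partners. -/
theorem matchedVertexSets_nonempty [Finite V] {X Y : Finset V}
    (hG : G.IsBipartiteWith (X : Set V) (Y : Set V)) {s : ℕ} (hs : s ≤ matchingNumber G) :
    (matchedVertexSets G X Y s).Nonempty := by
  classical
  obtain ⟨M, hM, hMs⟩ : matchingNumber G ∈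
      {k | ∃ M : G.Subgraph, M.IsMatching ∧ M.edgeSet.ncard = k} := by
    -- The supremum is attained: the empty matching gives nonemptiness, and the number of unordered
    -- pairs is an upper bound.
    refine Nat.sSup_mem ⟨0, ⊥, by simp [SimpleGraph.Subgraph.IsMatching], by simp⟩
      ⟨(Set.univ : Set (Sym2 V)).ncard, ?_⟩
    rintro _ ⟨M, -, rfl⟩
    exact Set.ncard_le_ncard (Set.subset_univ _) (Set.toFinite _)
  have hpartner : ∀ b, ∃ x, b ∈ M.verts → M.Adj b x := by
    intro b
    by_cases hb : b ∈ M.verts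
    · obtain ⟨x, hx, -⟩ := hM hb
      exact ⟨x, fun _ => hx⟩
    · exact ⟨b, fun h => absurd h hb⟩
  choose f hf using hpartner
  let B := Y.filter fun b => b ∈ M.verts
  have hB : IsMatchedInto G X B f := by
    constructor
    · intro a ha b hb hab
      have ha' := hf a (Finset.mem_filter.mp ha).2
      have hb' := hf b (Finset.mem_filter.mp hb).2
      rw [← hab] at hb'
      exact hM.eq_of_adj_right ha' hb'
    · intro b hb
      obtain ⟨hbY, hbM⟩ := Finset.mem_filter.mp hb
      exact ⟨hG.symm.mem_of_mem_adj hbY (hf b hbM).adj_sub, (hf b hbM).adj_sub⟩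
  have hcard : M.edgeSet.ncard ≤ B.card := by
    have hsub : M.edgeSet ⊆ (B.image fun b => s(b, f b) : Finset (Sym2 V)) := by
      have key : ∀ {u v}, u ∈ Y → M.Adj u v → s(u, v) ∈ B.image fun b => s(b, f b) := by
        intro u v hu huv
        refine Finset.mem_image.mpr ⟨u, Finset.mem_filter.mpr ⟨hu, M.edge_vert huv⟩, ?_⟩
        rw [hM.eq_of_adj_left (hf u (M.edge_vert huv)) huv]
      intro e
      refine Sym2.ind (fun u v huv => ?_) e
      have huv' : M.Adj u v := huv
      rcases hG.mem_of_adj huv'.adj_sub with ⟨-, h⟩ | ⟨h, -⟩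
      · rw [Sym2.eq_swap]
        exact key h huv'.symm
      · exact key h huv'
    calc M.edgeSet.ncard ≤ (B.image fun b => s(b, f b)).card := by
          rw [← Set.ncard_coe_finset]
          exact Set.ncard_le_ncard hsub (Finset.finite_toSet _)
      _ ≤ B.card := Finset.card_image_le
  obtain ⟨C, hCB, hCs⟩ := Finset.exists_subset_card_eq (hs.trans (hMs ▸ hcard))
  exact ⟨_, C, f, hCB.trans (Finset.filter_subset _ _), hCs, hB.subset hCB, rfl⟩

theorem squarefreePower_edgeIdeal_ne_bot [Finite V] {X Y : Finset V}
    (hG : G.IsBipartiteWith (X : Set V) (Y : Set V)) {s : ℕ} (hs : s ≤ matchingNumber G) :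
    squarefreePower (edgeIdeal K G) s ≠ ⊥ := by
  obtain ⟨A, hA⟩ := matchedVertexSets_nonempty hG hs
  rw [squarefreePower_edgeIdeal_eq hG]
  refine Submodule.ne_bot_iff _ |>.mpr ⟨MvPolynomial.monomial (exponentVector A) 1,
    Ideal.subset_span ⟨_, ⟨A, hA, rfl⟩, rfl⟩, ?_⟩
  rw [Ne, MvPolynomial.monomial_eq_zero]
  exact one_ne_zero

theorem regularityLE_squarefreePower_edgeIdeal {X Y : Finset V}
    (hG : G.IsBipartiteWith (X : Set V) (Y : Set V)) (s : ℕ) :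
    RegularityLE (squarefreePower (edgeIdeal K G) s) (X.card + s) := by
  rw [squarefreePower_edgeIdeal_eq hG]
  exact regularityLE_matchedVertexSets (Finset.disjoint_coe.mp hG.disjoint) s

end Matching

end SquarefreePowers

theorem mainTheorem2 {K V : Type*} [Field K] [Fintype V] [DecidableEq V]
    (G : SimpleGraph V) (X Y : Finset V)
    (hG : G.IsBipartiteWith (X : Set V) (Y : Set V)) (hXY : X ∪ Y = Finset.univ)
    (s : ℕ) (hs : 1 ≤ s) (hsG : s ≤ SquarefreePowers.matchingNumber G) :
    ∃ r : ℤ,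
      SquarefreePowers.HasRegularity
        (SquarefreePowers.squarefreePower (SquarefreePowers.edgeIdeal K G) s) r ∧
      r ≤ (min X.card Y.card : ℤ) + s := by
  have hX := SquarefreePowers.regularityLE_squarefreePower_edgeIdeal (K := K) hG s
  -- Exchanging the two sides gives the second bound; `r` is the least bound, hence below both.
  have hY := SquarefreePowers.regularityLE_squarefreePower_edgeIdeal (K := K) hG.symm s
  have hF : Nonempty (SquarefreePowers.MinimalGradedFreeResolution
      (SquarefreePowers.squarefreePower (SquarefreePowers.edgeIdeal K G) s)) := by
    apply SquarefreePowers.nonempty_minimalGradedFreeResolution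
    rw [SquarefreePowers.squarefreePower_edgeIdeal_eq hG]
    exact SquarefreePowers.isHomogeneousSubmodule_squarefreeIdeal _
  obtain ⟨r, hr, hmin⟩ := SquarefreePowers.exists_hasRegularity
    (SquarefreePowers.squarefreePower_edgeIdeal_ne_bot hG hsG) hF hX
  refine ⟨r, hr, ?_⟩
  have h₁ := hmin _ hX
  have h₂ := hmin _ hY
  omega
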